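/- Let $\nu$ be a compactly supported probability measure on $\mathbb R$. For a compactly supported probability measure $\mu$ on $\mathbb R$ with $[a_\mu,b_\mu]$ the convex hull of its support, write $\ell_\mu=a_\mu$, $G_\mu(z)=\int\frac{d\mu(y)}{z-y}$, with $G_\mu(\ell_\mu)=\lim_{y\uparrow \ell_\mu}G_\mu(y)\in[-\infty,0)$, and $S_\mu(x)=-\int\log|x-y|\,d\mu(y)$. Let $K_\mu$ be the inverse of the restriction of $G_\mu$ to $\mathbb R\setminus[a_\mu,b_\mu]$, and $R_\mu(s)=K_\mu(s)-\frac1s$. For $t>0$ let $v_t(u)=\inf\{v\ge 0:\int\frac{d\nu(y)}{(y-u)^2+v^2}\le\frac1t\}$, $\Omega_{\nu,t}=\{u+iv: v>v_t(u)\}$ and $H_{\nu,t}(z)=z+tG_\nu(z)$, and let $\omega_{\nu,t}$ be the inverse of $H_{\nu,t}:\overline{\Omega_{\nu,t}}\to\mathbb C^+\cup\mathbb R$. The free convolution $\nu\boxplus\sigma_t$ of $\nu$ with the semicircular law of variance $t$ is the probability measure with $G_{\nu\boxplus\sigma_t}=G_\nu\circ\omega_{\nu,t}$ on $\mathbb C^+$.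 Let $\ell_{\nu,t}$ be the left edge of its support. For $\Lambda\le\ell_\nu$ let $\rho_{\nu,t}^\Lambda=\Lambda+tG_\nu(\Lambda)\in[-\infty,\infty)$. For $\lambda\le\ell_{\nu,t}$ put $\gamma(\Lambda,\lambda)=\Lambda$ if $\Lambda\le\omega_{\nu,t}(\ell_{\nu,t})$, or if $\Lambda\ge\omega_{\nu,t}(\ell_{\nu,t})$ and $\lambda\le\rho_{\nu,t}^\Lambda$; otherwise let $\gamma(\Lambda,\lambda)=\omega^*_{\nu,t}(\lambda)$ be the unique solution $\gamma\in[\omega_{\nu,t}(\ell_{\nu,t}),\ell_\nu)$ of $H_{\nu,t}(\gamma)=\lambda$. Define $I_{\nu,t}^\Lambda(\lambda)=+\infty$ for $\lambda>\ell_{\nu,t}$ and, for $\lambda\le\ell_{\nu,t}$, with $\gamma=\gamma(\Lambda,\lambda)$, $$I_{\nu,t}^\Lambda(\lambda)=\tfrac12\bigl(S_\nu(\omega_{\nu,t}(\lambda))-S_\nu(\gamma)\bigr)+\tfrac1{4t}\bigl((\lambda-\gamma)^2-(\lambda-\omega_{\nu,t}(\lambda))^2\bigr).$$ For $\theta\le0$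 and $x\le\ell_\mu$ let $$J(\theta,\mu,x)=\begin{cases}\frac12\int_0^{2\theta}R_\mu(s)\,ds&\text{if } G_\mu(x)\le2\theta\le0,\\ \theta x-\frac12\bigl(1+\log(-2\theta)\bigr)-\frac12\int\log|x-y|\,d\mu(y)&\text{if }2\theta<G_\mu(x),\end{cases}$$ and let McKenna's rate function for the smallest eigenvalue be $J_\nu(x)=+\infty$ for $x>\ell_{\nu,1}$ and $$J_\nu(x)=\sup_{\theta\le0}\bigl\{J(\theta,\nu\boxplus\sigma_1,x)-J(\theta,\nu,\ell_\nu)-\theta^2\bigr\}\qquad(x\le\ell_{\nu,1}).$$ Then, with no outlier ($\Lambda=\ell_\nu$) and $t=1$, $J_\nu(x)=I_{\nu,1}^{\ell_\nu}(x)$ for every $x\in\mathbb R$. -/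

import Mathlib

open MeasureTheory Set Filter Topology
open scoped ENNReal

noncomputable section

/-- The left boundary point of the support of a measure on the real line. -/
def leftEdge (μ : Measure ℝ) : ℝ := sInf μ.support

/-- The right boundary point of the support of a measure on the real line. -/
def rightEdge (μ : Measure ℝ) : ℝ := sSup μ.support

/-- The Stieltjes transform of `μ` at a complex point. -/
def stieltjes (μ : Measure ℝ) (z : ℂ) : ℂ := ∫ x : ℝ, (z - (x : ℂ))⁻¹ ∂μ

/-- The Stieltjes transform of `μ` at a real point outside the support. -/
def stieltjesReal (μ : Measure ℝ) (x : ℝ) : ℝ := ∫ y : ℝ, (x - y)⁻¹ ∂μ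

/-- The Stieltjes transform on `(-∞, leftEdge μ]`, as an extended real: its value at the left edge
is the limit from the left (possibly `-∞`); at a point strictly to the left of the edge the limit
from the left is the value of the (continuous) function `stieltjesReal μ`. -/
def stieltjesLeft (μ : Measure ℝ) (x : ℝ) : EReal :=
  limUnder (𝓝[<] x) (fun y : ℝ => (stieltjesReal μ y : EReal))

/-- The logarithmic potential. -/
def logPotential (μ : Measure ℝ) (x : ℝ) : ℝ := -∫ y : ℝ, Real.log |x - y| ∂μ

/-- `v_t(u)`: the infimum of the `v ≥ 0` with `∫ dν(x) / ((x - u)² + v²) ≤ 1 / t`. The integral is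
taken in `[0, ∞]`, with `1 / 0 = ∞`. -/
def bianeV (ν : Measure ℝ) (t u : ℝ) : ℝ :=
  sInf {v : ℝ | 0 ≤ v ∧
    ∫⁻ x : ℝ, (ENNReal.ofReal ((x - u) ^ 2 + v ^ 2))⁻¹ ∂ν ≤ ENNReal.ofReal (1 / t)}

/-- The domain `Ω_{ν,t}` above the graph of `v_t`. -/
def bianeDomain (ν : Measure ℝ) (t : ℝ) : Set ℂ :=
  {z : ℂ | 0 < z.im ∧ bianeV ν t z.re < z.im}

/-- The map `H_{ν,t} : z ↦ z + t G_ν(z)`. -/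
def bianeH (ν : Measure ℝ) (t : ℝ) (z : ℂ) : ℂ := z + (t : ℂ) * stieltjes ν z

/-- The map `H_{ν,t}` on the real half-line to the left of the support of `ν`. -/
def bianeHReal (ν : Measure ℝ) (t x : ℝ) : ℝ := x + t * stieltjesReal ν x

/-- The subordination function `ω_{ν,t}`: the inverse of `H_{ν,t}`, from the closed upper
half-plane to the closure of `Ω_{ν,t}`. -/
def subordination (ν : Measure ℝ) (t : ℝ) (z : ℂ) : ℂ :=
  Function.invFunOn (bianeH ν t) (closure (bianeDomain ν t)) z

/-- The free convolution `ν ⊞ σ_t` of `ν` with the semicircular distribution of variance `t`: the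
probability measure whose Stieltjes transform on the upper half-plane is `G_ν ∘ ω_{ν,t}`. -/
def freeConvSemicircle (ν : Measure ℝ) (t : ℝ) : Measure ℝ :=
  Classical.epsilon (fun μ : Measure ℝ => IsProbabilityMeasure μ ∧
    ∀ z : ℂ, 0 < z.im → stieltjes μ z = stieltjes ν (subordination ν t z))

/-- `ℓ_{ν,t}`, the left edge of `ν ⊞ σ_t`. -/
def freeEdge (ν : Measure ℝ) (t : ℝ) : ℝ := leftEdge (freeConvSemicircle ν t)

/-- `ω_{ν,t}` at a real point `x ≤ ℓ_{ν,t}`, where it is real. -/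
def subordinationReal (ν : Measure ℝ) (t x : ℝ) : ℝ := (subordination ν t (x : ℂ)).re

/-- `ω*_{ν,t}(x)`: the solution `γ` of `H_{ν,t}(γ) = x` in `[ω_{ν,t}(ℓ_{ν,t}), ℓ_ν)`. -/
def subordinationStar (ν : Measure ℝ) (t x : ℝ) : ℝ :=
  Function.invFunOn (bianeHReal ν t)
    (Set.Ico (subordinationReal ν t (freeEdge ν t)) (leftEdge ν)) x

/-- `ρ_{ν,t}^Λ = Λ + t G_ν(Λ)` for `Λ ≤ ℓ_ν`, possibly `-∞` at `Λ = ℓ_ν`. -/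
def outlierPos (ν : Measure ℝ) (t Λ : ℝ) : EReal :=
  (Λ : EReal) + (t : EReal) * stieltjesLeft ν Λ

open Classical in
/-- The point `γ(Λ, x)`. -/
def gammaPoint (ν : Measure ℝ) (t Λ x : ℝ) : ℝ :=
  if Λ ≤ subordinationReal ν t (freeEdge ν t) ∨
      (subordinationReal ν t (freeEdge ν t) ≤ Λ ∧ (x : EReal) ≤ outlierPos ν t Λ)
  then Λ
  else subordinationStar ν t x

open Classical in
/-- The rate function `I_{ν,t}^Λ` for the smallest eigenvalue. -/
def rateFunction (ν : Measure ℝ) (t Λ x : ℝ) : EReal :=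
  if freeEdge ν t < x then ⊤
  else ((1 / 2 * (logPotential ν (subordinationReal ν t x) - logPotential ν (gammaPoint ν t Λ x))
      + 1 / (4 * t) * ((x - gammaPoint ν t Λ x) ^ 2 - (x - subordinationReal ν t x) ^ 2) : ℝ) :
        EReal)

/-- `K_μ`: the inverse of the Stieltjes transform on the complement in the real line of the convex
hull `[a, b]` of the support. -/
def inverseStieltjes (μ : Measure ℝ) (s : ℝ) : ℝ :=
  Function.invFunOn (stieltjesReal μ) (Set.Icc (leftEdge μ) (rightEdge μ))ᶜ s

/-- Voiculescu's `R`-transform. -/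
def rTransform (μ : Measure ℝ) (s : ℝ) : ℝ := inverseStieltjes μ s - 1 / s

open Classical in
/-- The function `J(θ, μ, x)` (limit of rank-one spherical integrals), in its form for the lower
edge: `θ ≤ 0` and `x ≤ leftEdge μ`. -/
def sphericalJ (θ : ℝ) (μ : Measure ℝ) (x : ℝ) : ℝ :=
  if stieltjesLeft μ x ≤ ((2 * θ : ℝ) : EReal)
  then 1 / 2 * ∫ s in (0 : ℝ)..(2 * θ), rTransform μ s
  else θ * x - 1 / 2 * (1 + Real.log (-(2 * θ))) - 1 / 2 * ∫ y : ℝ, Real.log |x - y| ∂μ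

/-- The function `J(x, θ)` under the supremum, for variance `t = 1`. -/
def mckennaJ (ν : Measure ℝ) (x θ : ℝ) : ℝ :=
  sphericalJ θ (freeConvSemicircle ν 1) x - sphericalJ θ ν (leftEdge ν) - θ ^ 2

open Classical in
/-- McKenna's variational rate function for the smallest eigenvalue (no outlier, `t = 1`). -/
def mckennaRate (ν : Measure ℝ) (x : ℝ) : EReal :=
  if freeEdge ν 1 < x then ⊤
  else ⨆ θ : Set.Iic (0 : ℝ), (mckennaJ ν x θ : EReal)

end

/-! Write G, S, H, ω for `stieltjesReal ν`, `logPotential ν`, `bianeHReal ν 1`, `subordinationReal ν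
1`, and ℓ for the left edge of ν. Let c ≤ ℓ be the last point with ∫ (c - y)⁻² dν ≤ 1. As H' = 1 - ∫
(k - y)⁻² dν, H increases on (-∞, c] and decreases on [c, ℓ). The free edge is H(c), so every finite
case is x = H(u) with u = ω(x) ≤ c.

Both rate functions are read off F(k) = (x - k)²/4 - S(k)/2 (`ratePotential`), which satisfies F' =
(H - x)/2. The explicit one is F(γ) - F(u). By `gammaPoint_spec`, H ≥ x on [u, γ) and H ≤ x on [γ,
ℓ), so γ maximizes F to the right of u (`ratePotential_le_gammaPoint`).

In the variational formula, let μ = ν ⊞ σ₁. If 2θ ≥ G(u), both spherical terms are integrals of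
R-transforms, and R_μ(s) = R_ν(s) + s makes the bracket vanish. If 2θ < G(u), let κ solve G(κ) = 2θ,
or κ = ℓ when 2θ is below the range of G. The identity S_μ(H(u)) = S(u) - G(u)²/2 and a completed
square turn the bracket into F(κ) - F(u) - (2θ - (x - κ))²/4 (`mckennaJ_eq`). This is at most F(γ) -
F(u), with equality at 2θ = x - γ, where κ = γ; if γ = u, the value 0 is reached at θ = 0.

The earlier part of the file makes these objects legitimate: ω is a chosen inverse and μ a chosen
measure. Following Biane, H is a homeomorphism from the closure of Ω onto the closed upper
half-plane, the Poisson formula produces a measure with transform G_ν ∘ ω, and any such measure has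
left edge H(c). -/

/-! ### Stieltjes transforms off the support -/

lemma stieltjes_eq_neg_resolventTransform (m : Measure ℝ) (z : ℂ) :
    stieltjes m z = -resolventTransform m z := by
  simp only [stieltjes, resolventTransform_apply, resolvent, Ring.inverse_eq_inv']
  rw [← integral_neg]
  congr 1 with y
  rw [← inv_neg, neg_sub]
  rfl

lemma integrable_inv_sub {m : Measure ℝ} [IsFiniteMeasure m] {z : ℂ}
    (hz : z ∉ (algebraMap ℝ ℂ) '' m.support) :
    Integrable (fun y : ℝ => (z - (y : ℂ))⁻¹) m := by
  refine (integrable_resolvent hz).neg.congr (ae_of_all _ fun y => ?_)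
  simp only [resolvent, Ring.inverse_eq_inv', Pi.neg_apply]
  rw [← inv_neg, neg_sub]
  rfl

lemma hasDerivAt_stieltjes {m : Measure ℝ} [IsFiniteMeasure m] {z : ℂ}
    (hz : z ∉ (algebraMap ℝ ℂ) '' m.support) :
    HasDerivAt (stieltjes m) (-∫ y : ℝ, ((z - (y : ℂ))⁻¹) ^ 2 ∂m) z := by
  have h := (hasDerivAt_resolventTransform z hz).neg
  have e : (-resolventTransform m : ℂ → ℂ) = stieltjes m := by
    ext z; simp [stieltjes_eq_neg_resolventTransform]
  rw [e] at h
  refine h.congr_deriv (congrArg Neg.neg (integral_congr_ae (ae_of_all _ fun y => ?_)))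
  simp only [resolvent, Ring.inverse_eq_inv']
  rw [show z - (y : ℂ) = -((algebraMap ℝ ℂ) y - z) by simp, inv_neg, neg_sq]

lemma notMem_image_support_of_im_ne {m : Measure ℝ} {z : ℂ} (hz : z.im ≠ 0) :
    z ∉ (algebraMap ℝ ℂ) '' m.support := by
  rintro ⟨y, -, rfl⟩
  simp at hz

lemma ofReal_notMem_image_support {m : Measure ℝ} {u : ℝ} (hu : u ∉ m.support) :
    (u : ℂ) ∉ (algebraMap ℝ ℂ) '' m.support := by
  rintro ⟨y, hy, h⟩
  simp only [Complex.coe_algebraMap, Complex.ofReal_inj] at h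
  exact hu (h ▸ hy)

lemma stieltjes_ofReal (m : Measure ℝ) (u : ℝ) : stieltjes m (u : ℂ) = (stieltjesReal m u : ℂ) := by
  simp only [stieltjes, stieltjesReal]
  rw [← integral_complex_ofReal]
  congr 1 with y
  push_cast
  rfl

/-- The integral of the squared Cauchy kernel, in `[0, ∞]`. -/
noncomputable def sqPotential (m : Measure ℝ) (z : ℂ) : ℝ≥0∞ :=
  ∫⁻ x : ℝ, (ENNReal.ofReal ((x - z.re) ^ 2 + z.im ^ 2))⁻¹ ∂m

lemma sq_add_sq_eq_norm_sub_sq (z : ℂ) (y : ℝ) :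
    (y - z.re) ^ 2 + z.im ^ 2 = ‖z - (y : ℂ)‖ ^ 2 := by
  rw [← Complex.normSq_eq_norm_sq, Complex.normSq_apply]
  simp
  ring

lemma measurable_sqKernel (z : ℂ) :
    Measurable (fun x : ℝ => (ENNReal.ofReal ((x - z.re) ^ 2 + z.im ^ 2))⁻¹) := by
  fun_prop

/-- Only an inequality: at y = z the left side is 0, as `0⁻¹ = 0`, while the right side is ∞. -/
lemma ofReal_norm_inv_sq_le (z : ℂ) (y : ℝ) :
    ENNReal.ofReal (‖(z - (y : ℂ))⁻¹‖ ^ 2) ≤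
      (ENNReal.ofReal ((y - z.re) ^ 2 + z.im ^ 2))⁻¹ := by
  rw [sq_add_sq_eq_norm_sub_sq, norm_inv, inv_pow]
  rcases (norm_nonneg (z - (y : ℂ))).eq_or_lt with h | h
  · simp [← h]
  · rw [ENNReal.ofReal_inv_of_pos (by positivity)]

lemma ofReal_norm_inv_sq_eq {z : ℂ} {y : ℝ} (h : (y : ℂ) ≠ z) :
    ENNReal.ofReal (‖(z - (y : ℂ))⁻¹‖ ^ 2) =
      (ENNReal.ofReal ((y - z.re) ^ 2 + z.im ^ 2))⁻¹ := by
  have h : 0 < ‖z - (y : ℂ)‖ := norm_pos_iff.2 (sub_ne_zero.2 h.symm)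
  rw [sq_add_sq_eq_norm_sub_sq, norm_inv, inv_pow, ENNReal.ofReal_inv_of_pos (by positivity)]

lemma aestronglyMeasurable_inv_sub (m : Measure ℝ) (z : ℂ) :
    AEStronglyMeasurable (fun y : ℝ => (z - (y : ℂ))⁻¹) m :=
  Measurable.aestronglyMeasurable (by fun_prop)

/-! ### Square-integrable Cauchy kernels -/

section SqPotential

variable {m : Measure ℝ} {z w : ℂ}

lemma integrable_norm_inv_sq (h : sqPotential m z ≠ ∞) :
    Integrable (fun y : ℝ => ‖(z - (y : ℂ))⁻¹‖ ^ 2) m := by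
  refine ⟨((aestronglyMeasurable_inv_sub m z).norm.pow 2), ?_⟩
  rw [hasFiniteIntegral_iff_ofReal (ae_of_all _ fun y => by positivity)]
  exact (lintegral_mono fun y => ofReal_norm_inv_sq_le z y).trans_lt h.lt_top

lemma memLp_two_inv_sub (h : sqPotential m z ≠ ∞) :
    MemLp (fun y : ℝ => (z - (y : ℂ))⁻¹) 2 m :=
  (memLp_two_iff_integrable_sq_norm (aestronglyMeasurable_inv_sub m z)).2
    (integrable_norm_inv_sq h)

lemma integral_norm_inv_sq_le (h : sqPotential m z ≤ 1) :
    ∫ y : ℝ, ‖(z - (y : ℂ))⁻¹‖ ^ 2 ∂m ≤ 1 := by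
  rw [integral_eq_lintegral_of_nonneg_ae (f := fun y : ℝ => ‖(z - (y : ℂ))⁻¹‖ ^ 2)
    (ae_of_all _ fun y => by positivity) ((aestronglyMeasurable_inv_sub m z).norm.pow 2)]
  refine ENNReal.toReal_le_of_le_ofReal zero_le_one ?_
  rw [ENNReal.ofReal_one]
  exact (lintegral_mono fun y => ofReal_norm_inv_sq_le z y).trans h

lemma ae_ne_of_sqPotential_ne_top (h : sqPotential m z ≠ ∞) : ∀ᵐ y : ℝ ∂m, (y : ℂ) ≠ z := by
  filter_upwards [ae_lt_top (measurable_sqKernel z) h] with y hy hyz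
  rw [sq_add_sq_eq_norm_sub_sq] at hy
  simp [hyz] at hy

lemma sqPotential_eq_ofReal_integral (h : ∀ᵐ y : ℝ ∂m, (y : ℂ) ≠ z)
    (hi : Integrable (fun y : ℝ => ‖(z - (y : ℂ))⁻¹‖ ^ 2) m) :
    sqPotential m z = ENNReal.ofReal (∫ y : ℝ, ‖(z - (y : ℂ))⁻¹‖ ^ 2 ∂m) := by
  rw [ofReal_integral_eq_lintegral_ofReal hi (ae_of_all _ fun y => by positivity)]
  refine lintegral_congr_ae ?_
  filter_upwards [h] with y hy
  exact (ofReal_norm_inv_sq_eq hy).symm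

lemma integrable_inv_mul_inv (hz : sqPotential m z ≠ ∞) (hw : sqPotential m w ≠ ∞) :
    Integrable (fun y : ℝ => (z - (y : ℂ))⁻¹ * (w - (y : ℂ))⁻¹) m :=
  (memLp_two_inv_sub hz).integrable_mul (memLp_two_inv_sub hw)


/-- Off the support the kernel is bounded, so the Bochner integral is the true value. On the support
it could drop an atom or default to 0. -/
lemma sqPotential_le_one_iff [IsProbabilityMeasure m] (hz : z ∉ (algebraMap ℝ ℂ) '' m.support) :
    sqPotential m z ≤ 1 ↔ ∫ y : ℝ, ‖(z - (y : ℂ))⁻¹‖ ^ 2 ∂m ≤ 1 := by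
  refine ⟨integral_norm_inv_sq_le, fun h => ?_⟩
  rw [sqPotential_eq_ofReal_integral]
  · simpa using h
  · filter_upwards [Measure.support_mem_ae (μ := m)] with y hy hyz
    exact hz ⟨y, hy, hyz⟩
  · have hb : ∀ᵐ y : ℝ ∂m, ‖(z - (y : ℂ))⁻¹‖ ≤
        (Metric.infDist z ((algebraMap ℝ ℂ) '' m.support))⁻¹ := by
      filter_upwards [Measure.support_mem_ae (μ := m)] with y hy
      have := norm_resolvent_le_inv_infDist_support hz hy
      rw [resolvent, Ring.inverse_eq_inv'] at this
      rwa [norm_inv, norm_sub_rev, ← norm_inv]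
    have : MemLp (fun y : ℝ => (z - (y : ℂ))⁻¹) 2 m :=
      MemLp.of_bound (aestronglyMeasurable_inv_sub m z) _ hb
    exact (memLp_two_iff_integrable_sq_norm (aestronglyMeasurable_inv_sub m z)).1 this

/-- By 2ab ≤ a² + b². With the resolvent identity this makes G 1-Lipschitz where the potential is at
most 1, including real points of the support. -/
lemma norm_integral_inv_mul_inv_le (hz : sqPotential m z ≤ 1) (hw : sqPotential m w ≤ 1) :
    ‖∫ y : ℝ, (z - (y : ℂ))⁻¹ * (w - (y : ℂ))⁻¹ ∂m‖ ≤ 1 := by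
  have hz' := (hz.trans_lt ENNReal.one_lt_top).ne
  have hw' := (hw.trans_lt ENNReal.one_lt_top).ne
  have i1 := integrable_norm_inv_sq hz'
  have i2 := integrable_norm_inv_sq hw'
  calc _ ≤ ∫ y : ℝ, ‖(z - (y : ℂ))⁻¹ * (w - (y : ℂ))⁻¹‖ ∂m := norm_integral_le_integral_norm _
    _ ≤ ∫ y : ℝ, 1 / 2 * (‖(z - (y : ℂ))⁻¹‖ ^ 2 + ‖(w - (y : ℂ))⁻¹‖ ^ 2) ∂m := by
      refine integral_mono (integrable_inv_mul_inv hz' hw').norm ((i1.add i2).const_mul _) ?_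
      intro y
      simp only [norm_mul]
      nlinarith [sq_nonneg (‖(z - (y : ℂ))⁻¹‖ - ‖(w - (y : ℂ))⁻¹‖)]
    _ = 1 / 2 * (∫ y : ℝ, ‖(z - (y : ℂ))⁻¹‖ ^ 2 ∂m + ∫ y : ℝ, ‖(w - (y : ℂ))⁻¹‖ ^ 2 ∂m) := by
      rw [integral_const_mul, integral_add i1 i2]
    _ ≤ 1 := by
      linarith [integral_norm_inv_sq_le hz, integral_norm_inv_sq_le hw]

variable [IsProbabilityMeasure m]

lemma integrable_inv_sub_of_sqPotential (h : sqPotential m z ≠ ∞) :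
    Integrable (fun y : ℝ => (z - (y : ℂ))⁻¹) m :=
  (memLp_two_inv_sub h).integrable (by norm_num)

lemma stieltjes_sub_stieltjes (hz : sqPotential m z ≠ ∞) (hw : sqPotential m w ≠ ∞) :
    stieltjes m z - stieltjes m w =
      (w - z) * ∫ y : ℝ, (z - (y : ℂ))⁻¹ * (w - (y : ℂ))⁻¹ ∂m := by
  rw [stieltjes, stieltjes, ← integral_sub (integrable_inv_sub_of_sqPotential hz)
    (integrable_inv_sub_of_sqPotential hw), ← integral_const_mul]
  refine integral_congr_ae ?_
  filter_upwards [ae_ne_of_sqPotential_ne_top hz, ae_ne_of_sqPotential_ne_top hw] with y h1 h2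
  have h1 := sub_ne_zero.2 h1.symm
  have h2 := sub_ne_zero.2 h2.symm
  field_simp
  ring

lemma norm_stieltjes_sub_le (hz : sqPotential m z ≤ 1) (hw : sqPotential m w ≤ 1) :
    ‖stieltjes m z - stieltjes m w‖ ≤ ‖z - w‖ := by
  rw [stieltjes_sub_stieltjes (hz.trans_lt ENNReal.one_lt_top).ne
    (hw.trans_lt ENNReal.one_lt_top).ne, norm_mul, norm_sub_rev]
  exact mul_le_of_le_one_right (norm_nonneg _) (norm_integral_inv_mul_inv_le hz hw)

lemma norm_stieltjes_le_one (hz : sqPotential m z ≤ 1) : ‖stieltjes m z‖ ≤ 1 := by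
  have i1 := integrable_norm_inv_sq (hz.trans_lt ENNReal.one_lt_top).ne
  calc _ ≤ ∫ y : ℝ, ‖(z - (y : ℂ))⁻¹‖ ∂m := norm_integral_le_integral_norm _
    _ ≤ ∫ y : ℝ, 1 / 2 * (‖(z - (y : ℂ))⁻¹‖ ^ 2 + 1) ∂m := by
      refine integral_mono
        (integrable_inv_sub_of_sqPotential (hz.trans_lt ENNReal.one_lt_top).ne).norm
        ((i1.add (integrable_const _)).const_mul _) ?_
      intro y
      nlinarith [sq_nonneg (‖(z - (y : ℂ))⁻¹‖ - 1)]
    _ = 1 / 2 * (∫ y : ℝ, ‖(z - (y : ℂ))⁻¹‖ ^ 2 ∂m + 1) := by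
      rw [integral_const_mul, integral_add i1 (integrable_const _)]
      simp
    _ ≤ 1 := by linarith [integral_norm_inv_sq_le hz]

end SqPotential

/-! ### Bounds in the upper half-plane -/

section UpperHalfPlane

variable {m : Measure ℝ} [IsFiniteMeasure m] {z : ℂ}

lemma im_inv_sub (z : ℂ) (y : ℝ) :
    ((z - (y : ℂ))⁻¹).im = -(z.im * ‖(z - (y : ℂ))⁻¹‖ ^ 2) := by
  rw [Complex.inv_im, Complex.normSq_eq_norm_sq, norm_inv]
  simp
  ring

lemma stieltjes_im (hz : z ∉ (algebraMap ℝ ℂ) '' m.support) :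
    (stieltjes m z).im = -(z.im * ∫ y : ℝ, ‖(z - (y : ℂ))⁻¹‖ ^ 2 ∂m) := by
  rw [stieltjes]
  have := integral_im (integrable_inv_sub hz)
  simp only [RCLike.im_to_complex] at this
  rw [← this]
  simp only [im_inv_sub]
  rw [integral_neg, integral_const_mul]

lemma norm_inv_sub_le (hz : z.im ≠ 0) (y : ℝ) : ‖(z - (y : ℂ))⁻¹‖ ≤ |z.im|⁻¹ := by
  rw [norm_inv]
  refine inv_anti₀ (abs_pos.2 hz) ?_
  simpa using Complex.abs_im_le_norm (z - (y : ℂ))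

lemma norm_stieltjes_le (hz : z.im ≠ 0) : ‖stieltjes m z‖ ≤ |z.im|⁻¹ * m.real univ :=
  norm_integral_le_of_norm_le_const (ae_of_all _ (norm_inv_sub_le hz))

lemma norm_mul_stieltjes_sub_le {M : ℝ} (hM : ∀ᵐ y ∂m, |y| ≤ M) (hz : z.im ≠ 0) :
    ‖z * stieltjes m z - (m.real univ : ℂ)‖ ≤ M * |z.im|⁻¹ * m.real univ := by
  have h : z * stieltjes m z - (m.real univ : ℂ) = ∫ y : ℝ, (y : ℂ) * (z - (y : ℂ))⁻¹ ∂m := by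
    have e : (m.real univ : ℂ) = ∫ y : ℝ, (1 : ℂ) ∂m := by simp
    rw [e, stieltjes, ← integral_const_mul, ← integral_sub
      ((integrable_inv_sub (notMem_image_support_of_im_ne hz)).const_mul _) (integrable_const _)]
    congr 1 with y
    have : z - (y : ℂ) ≠ 0 := fun h => hz (by simpa using congrArg Complex.im h)
    field_simp
    ring
  rw [h]
  refine norm_integral_le_of_norm_le_const ?_
  filter_upwards [hM] with y hy
  rw [norm_mul, Complex.norm_real, Real.norm_eq_abs]
  exact mul_le_mul hy (norm_inv_sub_le hz y) (norm_nonneg _) ((abs_nonneg _).trans hy)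

lemma differentiableOn_stieltjes : DifferentiableOn ℂ (stieltjes m) {z | 0 < z.im} :=
  fun _ hz => (hasDerivAt_stieltjes
    (notMem_image_support_of_im_ne (ne_of_gt hz))).differentiableAt.differentiableWithinAt

end UpperHalfPlane

/-! ### The domain Ω and its closure -/

section Domain

variable (ν : Measure ℝ)

/-- The closed set of points of the closed upper half-plane where `sqPotential ν` is at most `1`;
it is the closure of the domain `bianeDomain ν 1`. -/
def bianeClosure : Set ℂ := {z : ℂ | 0 ≤ z.im ∧ sqPotential ν z ≤ 1}

/-- Fatou's lemma: the potential is lower semicontinuous, also at real points. -/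
lemma isClosed_bianeClosure : IsClosed (bianeClosure ν) := by
  refine IsSeqClosed.isClosed fun x z hx hz => ⟨?_, ?_⟩
  · exact ge_of_tendsto' ((Complex.continuous_im.tendsto z).comp hz) fun n => (hx n).1
  · have h1 : sqPotential ν z ≤ liminf (fun n => sqPotential ν (x n)) atTop := by
      refine le_trans (lintegral_mono fun y => ?_)
        (lintegral_liminf_le (fun n => measurable_sqKernel (x n)))
      have hc : Continuous fun w : ℂ =>
          (ENNReal.ofReal ((y - w.re) ^ 2 + w.im ^ 2))⁻¹ :=
        continuous_inv.comp (ENNReal.continuous_ofReal.comp (by fun_prop))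
      exact ((hc.tendsto z).comp hz).liminf_eq.ge
    refine h1.trans ?_
    calc _ ≤ liminf (fun _ : ℕ => (1 : ℝ≥0∞)) atTop :=
          liminf_le_liminf (Eventually.of_forall fun n => (hx n).2)
      _ = 1 := by simp

variable {ν}

lemma sqPotential_anti {z w : ℂ} (hre : z.re = w.re) (h0 : 0 ≤ z.im) (h : z.im ≤ w.im) :
    sqPotential ν w ≤ sqPotential ν z := by
  refine lintegral_mono fun y => ?_
  rw [hre]
  gcongr

lemma sqPotential_le_one_of_dist {z : ℂ} [IsProbabilityMeasure ν]
    (h : ∀ᵐ y ∂ν, 1 ≤ (y - z.re) ^ 2 + z.im ^ 2) : sqPotential ν z ≤ 1 := by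
  calc sqPotential ν z ≤ ∫⁻ _, 1 ∂ν := by
        refine lintegral_mono_ae ?_
        filter_upwards [h] with y hy
        simpa using hy
    _ = 1 := by simp

lemma sqPotential_eq_setOf (u v : ℝ) :
    sqPotential ν ⟨u, v⟩ = ∫⁻ x : ℝ, (ENNReal.ofReal ((x - u) ^ 2 + v ^ 2))⁻¹ ∂ν := rfl

lemma bianeV_le {u v : ℝ} (h : (⟨u, v⟩ : ℂ) ∈ bianeClosure ν) : bianeV ν 1 u ≤ v := by
  refine csInf_le ⟨0, fun _ h => h.1⟩ ⟨h.1, ?_⟩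
  rw [← sqPotential_eq_setOf]
  simpa using h.2

variable [IsProbabilityMeasure ν]

lemma mem_bianeClosure_of_bianeV_lt {z : ℂ} (h : bianeV ν 1 z.re < z.im) :
    z ∈ bianeClosure ν := by
  have hne : {v : ℝ | 0 ≤ v ∧ ∫⁻ x : ℝ, (ENNReal.ofReal ((x - z.re) ^ 2 + v ^ 2))⁻¹ ∂ν ≤
      ENNReal.ofReal (1 / 1)}.Nonempty := by
    refine ⟨1, zero_le_one, ?_⟩
    rw [← sqPotential_eq_setOf]
    simp only [ne_eq, one_ne_zero, not_false_eq_true, div_self, ENNReal.ofReal_one]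
    refine sqPotential_le_one_of_dist (ae_of_all _ fun y => ?_)
    simp only [one_pow, le_add_iff_nonneg_left]
    positivity
  obtain ⟨v, ⟨hv0, hv⟩, hlt⟩ := exists_lt_of_csInf_lt hne h
  rw [← sqPotential_eq_setOf] at hv
  simp only [ne_eq, one_ne_zero, not_false_eq_true, div_self, ENNReal.ofReal_one] at hv
  exact ⟨hv0.trans hlt.le, (sqPotential_anti (z := ⟨z.re, v⟩) (w := z) rfl hv0 hlt.le).trans hv⟩

/-- A point of the closed set is the limit of its vertical translates by ε > 0, which lie strictly
above the graph of v. -/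
lemma closure_bianeDomain : closure (bianeDomain ν 1) = bianeClosure ν := by
  refine subset_antisymm (closure_minimal (fun z hz => mem_bianeClosure_of_bianeV_lt hz.2)
    (isClosed_bianeClosure ν)) fun z hz => ?_
  have ht : Tendsto (fun ε : ℝ => (⟨z.re, z.im + ε⟩ : ℂ)) (𝓝[>] 0) (𝓝 z) := by
    have : ContinuousAt (fun ε : ℝ => z + ε * Complex.I) 0 := by fun_prop
    have h := this.tendsto.mono_left (nhdsWithin_le_nhds (s := Ioi (0 : ℝ)))
    simp only [Complex.ofReal_zero, zero_mul, add_zero] at h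
    refine h.congr fun ε => ?_
    apply Complex.ext <;> simp
  refine mem_closure_of_tendsto ht ?_
  filter_upwards [self_mem_nhdsWithin] with ε hε
  have hε : 0 < ε := hε
  have h1 := bianeV_le (u := z.re) (v := z.im) hz
  exact ⟨by have := hz.1; show 0 < z.im + ε; linarith,
    by show bianeV ν 1 z.re < z.im + ε; linarith⟩

end Domain

/-! ### H as a homeomorphism, and its inverse ω -/

section Subordination

variable {ν : Measure ℝ}

lemma bianeH_one (z : ℂ) : bianeH ν 1 z = z + stieltjes ν z := by simp [bianeH]

lemma bianeHReal_one (x : ℝ) : bianeHReal ν 1 x = x + stieltjesReal ν x := by simp [bianeHReal]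

lemma bianeH_ofReal (x : ℝ) : bianeH ν 1 (x : ℂ) = (bianeHReal ν 1 x : ℂ) := by
  rw [bianeH_one, bianeHReal_one, stieltjes_ofReal]
  push_cast
  rfl

lemma ne_top_of_mem_bianeClosure {z : ℂ} (hz : z ∈ bianeClosure ν) : sqPotential ν z ≠ ∞ :=
  (hz.2.trans_lt ENNReal.one_lt_top).ne

lemma im_pos_of_bianeH_im_pos {z : ℂ} (hz : z ∈ bianeClosure ν) (h : 0 < (bianeH ν 1 z).im) :
    0 < z.im := by
  refine hz.1.lt_of_ne fun h0 => ?_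
  have : z = (z.re : ℂ) := Complex.ext rfl (by simp [← h0])
  rw [this, bianeH_ofReal, Complex.ofReal_im] at h
  exact h.false

variable [IsProbabilityMeasure ν]

lemma continuousOn_stieltjes : ContinuousOn (stieltjes ν) (bianeClosure ν) := by
  refine (LipschitzOnWith.of_dist_le_mul (K := 1) fun z hz w hw => ?_).continuousOn
  simpa [dist_eq_norm] using norm_stieltjes_sub_le hz.2 hw.2

lemma continuousOn_bianeH : ContinuousOn (bianeH ν 1) (bianeClosure ν) := by
  simp only [funext bianeH_one]
  exact continuousOn_id.add continuousOn_stieltjes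

/-- Equality case of Cauchy–Schwarz. If H(z) = H(w) with z ≠ w, then ∫ (z - y)⁻¹ (w - y)⁻¹ dν = 1,
while both factors have L² norm at most 1. Hence one factor is a.e. the conjugate of the other, z is
the conjugate of w, and Im z, Im w ≥ 0 forces z = w. -/
lemma injOn_bianeH : InjOn (bianeH ν 1) (bianeClosure ν) := by
  intro z hz w hw h
  by_contra hne
  have hz' := ne_top_of_mem_bianeClosure hz
  have hw' := ne_top_of_mem_bianeClosure hw
  have i1 := integrable_norm_inv_sq hz'
  have i2 := integrable_norm_inv_sq hw'
  have i3 := integrable_inv_mul_inv hz' hw'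
  have hone : ∫ y : ℝ, (z - (y : ℂ))⁻¹ * (w - (y : ℂ))⁻¹ ∂ν = 1 := by
    have h2 := stieltjes_sub_stieltjes hz' hw'
    simp only [bianeH_one] at h
    have h3 : stieltjes ν z - stieltjes ν w = w - z := by linear_combination h
    rw [h3] at h2
    exact (mul_left_cancel₀ (sub_ne_zero.2 (Ne.symm hne)) (by rw [← h2, mul_one]))
  have key : ∀ a b : ℂ, ‖a - (starRingEnd ℂ) b‖ ^ 2 = ‖a‖ ^ 2 + ‖b‖ ^ 2 - 2 * (a * b).re := by
    intro a b
    simp only [← Complex.normSq_eq_norm_sq, Complex.normSq_apply]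
    simp
    ring
  have i4 : Integrable (fun y : ℝ => ((z - (y : ℂ))⁻¹ * (w - (y : ℂ))⁻¹).re) ν := i3.re
  have hint : ∫ y : ℝ, ‖(z - (y : ℂ))⁻¹ - (starRingEnd ℂ) (w - (y : ℂ))⁻¹‖ ^ 2 ∂ν ≤ 0 := by
    have hre : ∫ y : ℝ, ((z - (y : ℂ))⁻¹ * (w - (y : ℂ))⁻¹).re ∂ν = 1 := by
      have := integral_re i3
      simp only [RCLike.re_to_complex] at this
      rw [this, hone, Complex.one_re]
    have hsub := integral_sub
      (f := fun y : ℝ => ‖(z - (y : ℂ))⁻¹‖ ^ 2 + ‖(w - (y : ℂ))⁻¹‖ ^ 2) (i1.add i2)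
      (i4.const_mul 2)
    rw [integral_add i1 i2, integral_const_mul, hre] at hsub
    simp only [key]
    rw [hsub]
    linarith [integral_norm_inv_sq_le hz.2, integral_norm_inv_sq_le hw.2]
  have hint0 : Integrable
      (fun y : ℝ => ‖(z - (y : ℂ))⁻¹ - (starRingEnd ℂ) (w - (y : ℂ))⁻¹‖ ^ 2) ν := by
    simp only [key]
    exact (i1.add i2).sub (i4.const_mul 2)
  have h0 := (integral_eq_zero_iff_of_nonneg (fun y => by positivity) hint0).1
    (le_antisymm hint (integral_nonneg fun y => by positivity))
  obtain ⟨y, hy⟩ := h0.exists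
  simp only [Pi.zero_apply, ne_eq, OfNat.ofNat_ne_zero, not_false_eq_true, pow_eq_zero_iff,
    norm_eq_zero, sub_eq_zero, map_inv₀, map_sub, Complex.conj_ofReal, inv_inj, sub_left_inj] at hy
  have him := congrArg Complex.im hy
  simp only [Complex.conj_im] at him
  have h1 := hz.1
  have h2 := hw.1
  refine hne (Complex.ext ?_ (by linarith))
  simpa using congrArg Complex.re hy

lemma norm_le_norm_bianeH_add_one {z : ℂ} (hz : z ∈ bianeClosure ν) :
    ‖z‖ ≤ ‖bianeH ν 1 z‖ + 1 := by
  have h := norm_sub_le (bianeH ν 1 z) (stieltjes ν z)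
  rw [bianeH_one, add_sub_cancel_right] at h
  rw [bianeH_one]
  linarith [norm_stieltjes_le_one hz.2]

/-- H differs from the identity by at most 1, hence is proper. The closed range gives surjectivity,
the embedding gives continuity of ω. -/
lemma isClosedEmbedding_bianeH :
    IsClosedEmbedding (fun z : bianeClosure ν => bianeH ν 1 z) := by
  have hc : Continuous (fun z : bianeClosure ν => bianeH ν 1 z) :=
    continuousOn_iff_continuous_domRestrict.1 continuousOn_bianeH
  refine .of_continuous_injective_isClosedMap hc
    (fun z w h => Subtype.ext (injOn_bianeH z.2 w.2 h)) ?_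
  refine (isProperMap_iff_tendsto_cocompact.2 ⟨hc, ?_⟩).isClosedMap
  rw [← Metric.cobounded_eq_cocompact (α := ℂ), ← tendsto_norm_atTop_iff_cobounded]
  have h1 : Tendsto (fun z : bianeClosure ν => ‖(z : ℂ)‖ - 1) (cocompact _) atTop :=
    tendsto_atTop_add_const_right _ _ (tendsto_norm_cocompact_atTop.comp
      (isClosed_bianeClosure ν).isClosedEmbedding_subtypeVal.tendsto_cocompact)
  exact tendsto_atTop_mono (fun z => by linarith [norm_le_norm_bianeH_add_one z.2]) h1

lemma bianeH_im {z : ℂ} (hz : z.im ≠ 0) :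
    (bianeH ν 1 z).im = z.im * (1 - ∫ y : ℝ, ‖(z - (y : ℂ))⁻¹‖ ^ 2 ∂ν) := by
  rw [bianeH_one, Complex.add_im, stieltjes_im (notMem_image_support_of_im_ne hz)]
  ring

lemma bianeH_im_le {z : ℂ} (hz : 0 < z.im) : (bianeH ν 1 z).im ≤ z.im := by
  rw [bianeH_im hz.ne']
  have : 0 ≤ ∫ y : ℝ, ‖(z - (y : ℂ))⁻¹‖ ^ 2 ∂ν := integral_nonneg fun y => by positivity
  nlinarith

/-- From Im H(z) = Im z · (1 - ∫ |z - y|⁻² dν). -/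
lemma mem_bianeClosure_iff_bianeH_im_nonneg {z : ℂ} (hz : 0 < z.im) :
    z ∈ bianeClosure ν ↔ 0 ≤ (bianeH ν 1 z).im := by
  rw [bianeH_im hz.ne', mul_nonneg_iff_of_pos_left hz, sub_nonneg,
    ← sqPotential_le_one_iff (notMem_image_support_of_im_ne hz.ne')]
  exact ⟨fun h => h.2, fun h => ⟨hz.le, h⟩⟩

lemma bianeH_im_nonneg {z : ℂ} (hz : z ∈ bianeClosure ν) : 0 ≤ (bianeH ν 1 z).im := by
  rcases hz.1.eq_or_lt with h | h
  · have : z = (z.re : ℂ) := Complex.ext rfl (by simp [← h])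
    rw [this, bianeH_ofReal, Complex.ofReal_im]
  · exact (mem_bianeClosure_iff_bianeH_im_nonneg h).1 hz

lemma isOpen_upperHalfPlane : IsOpen {z : ℂ | 0 < z.im} :=
  isOpen_lt continuous_const Complex.continuous_im

lemma differentiableOn_bianeH : DifferentiableOn ℂ (bianeH ν 1) {z | 0 < z.im} := by
  simp only [funext bianeH_one]
  exact differentiableOn_id.add differentiableOn_stieltjes

lemma hasStrictDerivAt_bianeH {z : ℂ} (hz : 0 < z.im) :
    HasStrictDerivAt (bianeH ν 1) (deriv (bianeH ν 1) z) z :=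
  (differentiableOn_bianeH.analyticAt (isOpen_upperHalfPlane.mem_nhds hz)).hasStrictDerivAt

lemma deriv_bianeH_ne_zero {z : ℂ} (hz : 0 < z.im) (h : 0 < (bianeH ν 1 z).im) :
    deriv (bianeH ν 1) z ≠ 0 := by
  have hd := (hasDerivAt_id z).add
    (hasDerivAt_stieltjes (m := ν) (notMem_image_support_of_im_ne hz.ne'))
  have e : (id + stieltjes ν) = bianeH ν 1 := by ext z; simp [bianeH_one]
  rw [e] at hd
  rw [hd.deriv]
  rw [bianeH_im hz.ne', mul_pos_iff_of_pos_left hz, sub_pos] at h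
  have h2 : ‖∫ y : ℝ, ((z - (y : ℂ))⁻¹) ^ 2 ∂ν‖ < 1 := by
    refine (norm_integral_le_integral_norm _).trans_lt ?_
    simpa only [norm_pow] using h
  intro h0
  have h3 : ∫ y : ℝ, ((z - (y : ℂ))⁻¹) ^ 2 ∂ν = 1 := by linear_combination -h0
  rw [h3] at h2
  simp at h2

/-- Connectedness: the set of values in the upper half-plane is open, since H' ≠ 0 there, and
relatively closed, since H has closed range. -/
lemma exists_bianeH_eq {z : ℂ} (hz : 0 < z.im) : ∃ w : ℂ, 0 < w.im ∧ bianeH ν 1 w = z := by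
  set E : Set ℂ := {z | 0 < z.im ∧ ∃ w : ℂ, 0 < w.im ∧ bianeH ν 1 w = z} with hE
  have hpre : IsPreconnected {z : ℂ | 0 < z.im} := (convex_halfSpace_im_gt 0).isPreconnected
  have hopen : IsOpen E := by
    rw [isOpen_iff_mem_nhds]
    rintro _ ⟨h1, w, hw, rfl⟩
    have h2 : bianeH ν 1 '' {z | 0 < z.im} ∈ 𝓝 (bianeH ν 1 w) := by
      rw [← (hasStrictDerivAt_bianeH hw).map_nhds_eq (deriv_bianeH_ne_zero hw h1)]
      exact image_mem_map (isOpen_upperHalfPlane.mem_nhds hw)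
    filter_upwards [h2, isOpen_upperHalfPlane.mem_nhds h1] with z hz hz0
    exact ⟨hz0, hz⟩
  have hne : ({z : ℂ | 0 < z.im} ∩ E).Nonempty := by
    -- At 2i one has |G| ≤ 1/2, so Im H ≥ 3/2.
    have h2 : 0 < (bianeH ν 1 (2 * Complex.I)).im := by
      rw [bianeH_one, Complex.add_im]
      have h3 := norm_stieltjes_le (m := ν) (z := 2 * Complex.I) (by simp)
      have h4 := (Complex.abs_im_le_norm _).trans h3
      simp only [Complex.mul_im, Complex.re_ofNat, Complex.I_im, mul_one, Complex.im_ofNat,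
        Complex.I_re, mul_zero, add_zero, Nat.abs_ofNat, probReal_univ] at h4 ⊢
      have := abs_le.1 h4
      norm_num at this ⊢
      linarith
    exact ⟨_, h2, h2, 2 * Complex.I, by simp, rfl⟩
  have hclosed : closure E ∩ {z : ℂ | 0 < z.im} ⊆ E := by
    rintro z ⟨hzE, hz⟩
    obtain ⟨x, hx, hxz⟩ := mem_closure_iff_seq_limit.1 hzE
    choose hx0 w hw hwx using hx
    have hmem : ∀ n, w n ∈ bianeClosure ν := fun n =>
      (mem_bianeClosure_iff_bianeH_im_nonneg (hw n)).2 (by rw [hwx]; exact (hx0 n).le)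
    have hcl := (isClosedEmbedding_bianeH (ν := ν)).isClosed_range
    have : z ∈ range (fun z : bianeClosure ν => bianeH ν 1 z) :=
      hcl.mem_of_tendsto hxz (Eventually.of_forall fun n => ⟨⟨w n, hmem n⟩, hwx n⟩)
    obtain ⟨w, rfl⟩ := this
    exact ⟨hz, w, im_pos_of_bianeH_im_pos w.2 hz, rfl⟩
  exact (hpre.subset_of_closure_inter_subset hopen hne hclosed hz).2

lemma surjOn_bianeH : SurjOn (bianeH ν 1) (bianeClosure ν) {z | 0 ≤ z.im} := by
  intro z hz
  have hcl := (isClosedEmbedding_bianeH (ν := ν)).isClosed_range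
  have ht : Tendsto (fun ε : ℝ => z + ε * Complex.I) (𝓝[>] 0) (𝓝 z) := by
    have : ContinuousAt (fun ε : ℝ => z + ε * Complex.I) 0 := by fun_prop
    simpa using this.tendsto.mono_left (nhdsWithin_le_nhds (s := Ioi (0 : ℝ)))
  have : z ∈ range (fun z : bianeClosure ν => bianeH ν 1 z) := by
    refine hcl.mem_of_tendsto ht ?_
    filter_upwards [self_mem_nhdsWithin] with ε hε
    have hε : 0 < ε := hε
    have hpos : 0 < (z + ε * Complex.I).im := by
      have : 0 ≤ z.im := hz
      simp
      linarith
    obtain ⟨w, hw, hwz⟩ := exists_bianeH_eq (ν := ν) hpos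
    exact ⟨⟨w, (mem_bianeClosure_iff_bianeH_im_nonneg hw).2 (hwz ▸ hpos.le)⟩, hwz⟩
  obtain ⟨w, rfl⟩ := this
  exact ⟨w, w.2, rfl⟩

lemma subordination_mem {z : ℂ} (hz : 0 ≤ z.im) : subordination ν 1 z ∈ bianeClosure ν := by
  rw [subordination, closure_bianeDomain]
  exact Function.invFunOn_mem (surjOn_bianeH hz)

lemma bianeH_subordination {z : ℂ} (hz : 0 ≤ z.im) : bianeH ν 1 (subordination ν 1 z) = z := by
  rw [subordination, closure_bianeDomain]
  exact Function.invFunOn_eq (surjOn_bianeH hz)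

lemma subordination_bianeH {w : ℂ} (hw : w ∈ bianeClosure ν) :
    subordination ν 1 (bianeH ν 1 w) = w :=
  injOn_bianeH (subordination_mem (bianeH_im_nonneg hw)) hw
    (bianeH_subordination (bianeH_im_nonneg hw))

lemma stieltjes_subordination {z : ℂ} (hz : 0 ≤ z.im) :
    stieltjes ν (subordination ν 1 z) = z - subordination ν 1 z := by
  have h := bianeH_subordination (ν := ν) hz
  rw [bianeH_one] at h
  linear_combination h

lemma im_le_im_subordination {z : ℂ} (hz : 0 < z.im) : z.im ≤ (subordination ν 1 z).im := by
  have h := bianeH_subordination (ν := ν) hz.le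
  have h1 := im_pos_of_bianeH_im_pos (subordination_mem hz.le) (h.symm ▸ hz)
  simpa [h] using bianeH_im_le (ν := ν) h1

lemma continuousOn_subordination : ContinuousOn (subordination ν 1) {z | 0 ≤ z.im} := by
  rw [continuousOn_iff_continuous_domRestrict]
  have hi : Continuous fun z : {z : ℂ | 0 ≤ z.im} =>
      (⟨subordination ν 1 z, subordination_mem z.2⟩ : bianeClosure ν) := by
    rw [(isClosedEmbedding_bianeH (ν := ν)).isInducing.continuous_iff]
    exact continuous_subtype_val.congr fun z => (bianeH_subordination z.2).symm
  exact continuous_subtype_val.comp hi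

lemma differentiableOn_subordination :
    DifferentiableOn ℂ (subordination ν 1) {z | 0 < z.im} := by
  intro z hz
  have hz : 0 < z.im := hz
  have h := bianeH_subordination (ν := ν) hz.le
  have h1 := im_pos_of_bianeH_im_pos (subordination_mem hz.le) (h.symm ▸ hz)
  have hc : ContinuousAt (subordination ν 1) z :=
    (continuousOn_subordination.mono fun w (hw : 0 < w.im) => hw.le).continuousAt
      (isOpen_upperHalfPlane.mem_nhds hz)
  refine (HasDerivAt.of_local_left_inverse hc (hasStrictDerivAt_bianeH h1).hasDerivAt
    (deriv_bianeH_ne_zero h1 (h.symm ▸ hz)) ?_).differentiableAt.differentiableWithinAt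
  filter_upwards [isOpen_upperHalfPlane.mem_nhds hz] with w hw
  exact bianeH_subordination (le_of_lt hw)

end Subordination

/-! ### The Poisson formula in the half-plane -/

section Poisson

lemma poissonKernel_eq {z : ℂ} (hz : 0 < z.im) (x : ℝ) :
    ‖(z - (x : ℂ))⁻¹‖ ^ 2 =
      Real.pi / z.im * ProbabilityTheory.cauchyPDFReal z.re z.im.toNNReal x := by
  rw [ProbabilityTheory.cauchyPDFReal_def, Real.coe_toNNReal _ hz.le, sq_add_sq_eq_norm_sub_sq, norm_inv,
    inv_pow]
  field_simp

lemma integrable_poissonKernel {z : ℂ} (hz : 0 < z.im) :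
    Integrable (fun x : ℝ => ‖(z - (x : ℂ))⁻¹‖ ^ 2) := by
  simp only [poissonKernel_eq hz]
  exact (ProbabilityTheory.integrable_cauchyPDFReal _).const_mul _

lemma integral_poissonKernel {z : ℂ} (hz : 0 < z.im) :
    ∫ x : ℝ, ‖(z - (x : ℂ))⁻¹‖ ^ 2 = Real.pi / z.im := by
  simp only [poissonKernel_eq hz]
  rw [integral_const_mul, ProbabilityTheory.integral_cauchyPDFReal_eq_one _
    (Real.toNNReal_pos.2 hz).ne', mul_one]

lemma sub_conj_ne_zero {z w : ℂ} (hz : 0 < z.im) (hw : 0 ≤ w.im) :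
    w - (starRingEnd ℂ) z ≠ 0 := by
  intro h
  have := congrArg Complex.im h
  simp at this
  linarith

variable {f : ℂ → ℂ} {C : ℝ}

lemma norm_dslope_mul_inv_le (hb : ∀ z : ℂ, 0 ≤ z.im → ‖f z‖ ≤ C) {z w : ℂ} (hz : 0 < z.im)
    (hw : 0 ≤ w.im) {R : ℝ} (hR : 2 * ‖z‖ < R) (hwR : R ≤ ‖w‖) :
    ‖dslope f z w * (w - (starRingEnd ℂ) z)⁻¹‖ ≤ 8 * C / R ^ 2 := by
  have hz0 := norm_nonneg z
  have h1 : R / 2 ≤ ‖w - z‖ := by linarith [norm_sub_norm_le w z]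
  have h2 : R / 2 ≤ ‖w - (starRingEnd ℂ) z‖ := by
    have := norm_sub_norm_le w ((starRingEnd ℂ) z)
    rw [Complex.norm_conj] at this
    linarith
  have hne : w ≠ z := by
    rintro rfl
    linarith
  have hR0 : 0 < R / 2 := by linarith
  rw [dslope_of_ne _ hne, slope_def_field, norm_mul, norm_div, norm_inv, div_eq_mul_inv]
  have h3 : ‖f w - f z‖ ≤ 2 * C := by linarith [norm_sub_le (f w) (f z), hb w hw, hb z hz.le]
  have hC : 0 ≤ 2 * C := (norm_nonneg _).trans h3
  calc _ ≤ 2 * C * (R / 2)⁻¹ * (R / 2)⁻¹ := by gcongr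
    _ = 8 * C / R ^ 2 := by
      have : R ≠ 0 := by linarith
      field_simp
      ring

lemma continuousOn_dslope_mul_inv (hc : ContinuousOn f {z | 0 ≤ z.im})
    (hd : DifferentiableOn ℂ f {z | 0 < z.im}) {z : ℂ} (hz : 0 < z.im) :
    ContinuousOn (fun w => dslope f z w * (w - (starRingEnd ℂ) z)⁻¹) {z | 0 ≤ z.im} := by
  refine ContinuousOn.mul ((continuousOn_dslope ?_).2 ⟨hc, ?_⟩) ?_
  · filter_upwards [isOpen_upperHalfPlane.mem_nhds hz] with w hw
    exact le_of_lt hw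
  · exact hd.differentiableAt (isOpen_upperHalfPlane.mem_nhds hz)
  · exact (continuousOn_id.sub continuousOn_const).inv₀ fun w hw => sub_conj_ne_zero hz hw

/-- Cauchy's theorem on [-R, R] × [0, R]: the singularity at z is removable and the pole at the
conjugate of z lies outside. The integrand is at most 8C/R² on the other three sides, of total
length 4R. -/
lemma norm_integral_dslope_mul_inv_le (hc : ContinuousOn f {z | 0 ≤ z.im})
    (hd : DifferentiableOn ℂ f {z | 0 < z.im}) (hb : ∀ z : ℂ, 0 ≤ z.im → ‖f z‖ ≤ C)
    {z : ℂ} (hz : 0 < z.im) {R : ℝ} (hR : 2 * ‖z‖ < R) :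
    ‖∫ x in -R..R, dslope f z x * ((x : ℂ) - (starRingEnd ℂ) z)⁻¹‖ ≤ 32 * C / R := by
  set q : ℂ → ℂ := fun w => dslope f z w * (w - (starRingEnd ℂ) z)⁻¹ with hq
  have hR0 : 0 < R := lt_of_le_of_lt (by positivity) hR
  have hqc : ContinuousOn q {z | 0 ≤ z.im} := continuousOn_dslope_mul_inv hc hd hz
  have hrect := Complex.integral_boundary_rect_eq_zero_of_differentiable_on_off_countable q
    (-R : ℝ) ⟨R, R⟩ {z} (countable_singleton z)
    (hqc.mono fun w hw => by
      have h2 := hw.2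
      simp only [Complex.ofReal_im, uIcc_of_le hR0.le, mem_preimage] at h2
      exact h2.1)
    (fun w hw => by
      have h2 := hw.1.2
      simp only [Complex.ofReal_im, min_eq_left hR0.le, max_eq_right hR0.le, mem_preimage] at h2
      have h3 : w ≠ z := hw.2
      refine DifferentiableAt.mul ((differentiableAt_dslope_of_ne h3).2
        (hd.differentiableAt (isOpen_upperHalfPlane.mem_nhds h2.1))) ?_
      exact (differentiableAt_id.sub (differentiableAt_const _)).inv
        (sub_conj_ne_zero hz h2.1.le))
  simp only [Complex.ofReal_im, Complex.ofReal_re, Complex.ofReal_zero, zero_mul, add_zero]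
    at hrect
  have hbd : ∀ w : ℂ, 0 ≤ w.im → R ≤ ‖w‖ → ‖q w‖ ≤ 8 * C / R ^ 2 := fun w hw hwR =>
    norm_dslope_mul_inv_le hb hz hw hR hwR
  have e1 : ‖∫ x in -R..R, q (x + R * Complex.I)‖ ≤ 8 * C / R ^ 2 * |R - -R| := by
    refine intervalIntegral.norm_integral_le_of_norm_le_const fun x _ => hbd _ ?_ ?_
    · simpa using hR0.le
    · refine le_trans ?_ (Complex.abs_im_le_norm _)
      simpa using le_abs_self R
  have e2 : ‖∫ y in (0 : ℝ)..R, q (R + y * Complex.I)‖ ≤ 8 * C / R ^ 2 * |R - 0| := by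
    refine intervalIntegral.norm_integral_le_of_norm_le_const fun y hy => hbd _ ?_ ?_
    · rw [uIoc_of_le hR0.le] at hy
      simpa using hy.1.le
    · refine le_trans ?_ (Complex.abs_re_le_norm _)
      simpa using le_abs_self R
  have e3 : ‖∫ y in (0 : ℝ)..R, q ((-R : ℝ) + y * Complex.I)‖ ≤ 8 * C / R ^ 2 * |R - 0| := by
    refine intervalIntegral.norm_integral_le_of_norm_le_const fun y hy => hbd _ ?_ ?_
    · rw [uIoc_of_le hR0.le] at hy
      simpa using hy.1.le
    · refine le_trans ?_ (Complex.abs_re_le_norm _)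
      simpa using le_abs_self R
  have e : ∫ x in -R..R, q x = (∫ x in -R..R, q (x + R * Complex.I))
      - Complex.I • (∫ y in (0 : ℝ)..R, q (R + y * Complex.I))
      + Complex.I • ∫ y in (0 : ℝ)..R, q ((-R : ℝ) + y * Complex.I) := by
    linear_combination hrect
  change ‖∫ x in -R..R, q x‖ ≤ _
  rw [e]
  refine (norm_add_le _ _).trans ((add_le_add_left (norm_sub_le _ _) _).trans ?_)
  rw [norm_smul, norm_smul, Complex.norm_I, one_mul, one_mul]
  rw [sub_neg_eq_add, abs_of_pos (by linarith)] at e1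
  rw [sub_zero, abs_of_pos hR0] at e2 e3
  refine (add_le_add (add_le_add e1 e2) e3).trans (le_of_eq ?_)
  field_simp
  ring

/-- The Poisson formula for a bounded function on the closed upper half-plane. -/
lemma integral_sub_mul_poissonKernel (hc : ContinuousOn f {z | 0 ≤ z.im})
    (hd : DifferentiableOn ℂ f {z | 0 < z.im}) (hb : ∀ z : ℂ, 0 ≤ z.im → ‖f z‖ ≤ C)
    {z : ℂ} (hz : 0 < z.im) :
    ∫ x : ℝ, (f x - f z) * ((‖(z - (x : ℂ))⁻¹‖ ^ 2 : ℝ) : ℂ) = 0 := by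
  -- On the real line |z - x|² = (x - z)(x - z̄).
  have hq : ∀ x : ℝ, (f x - f z) * ((‖(z - (x : ℂ))⁻¹‖ ^ 2 : ℝ) : ℂ) =
      dslope f z x * ((x : ℂ) - (starRingEnd ℂ) z)⁻¹ := by
    intro x
    have hne : (x : ℂ) ≠ z := by
      rintro rfl
      simp at hz
    rw [dslope_of_ne _ hne, slope_def_field, ← Complex.normSq_eq_norm_sq, map_inv₀,
      Complex.ofReal_inv, Complex.normSq_eq_conj_mul_self]
    simp only [map_sub, Complex.conj_ofReal]
    have h1 := sub_ne_zero.2 hne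
    have h2 := sub_ne_zero.2 hne.symm
    have h3 : (x : ℂ) - (starRingEnd ℂ) z ≠ 0 := sub_conj_ne_zero hz (by simp)
    have h4 : (starRingEnd ℂ) z - (x : ℂ) ≠ 0 := by
      rw [← neg_sub]
      exact neg_ne_zero.2 h3
    field_simp
    ring
  have hcx : Continuous fun x : ℝ => f x :=
    hc.comp_continuous Complex.continuous_ofReal fun x => by simp
  have hint : Integrable fun x : ℝ => (f x - f z) * ((‖(z - (x : ℂ))⁻¹‖ ^ 2 : ℝ) : ℂ) := by
    refine (integrable_poissonKernel hz).ofReal.bdd_mul (c := C + C)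
      (hcx.sub continuous_const).aestronglyMeasurable (ae_of_all _ fun x => ?_)
    exact (norm_sub_le _ _).trans (add_le_add (hb _ (by simp)) (hb _ hz.le))
  have h1 := intervalIntegral_tendsto_integral hint tendsto_neg_atTop_atBot tendsto_id
  have h2 : Tendsto (fun R : ℝ => ∫ x in -R..R,
      (f x - f z) * ((‖(z - (x : ℂ))⁻¹‖ ^ 2 : ℝ) : ℂ)) atTop (𝓝 0) := by
    refine squeeze_zero_norm' ?_ ((tendsto_const_nhds (x := 32 * C)).div_atTop tendsto_id)
    filter_upwards [eventually_gt_atTop (2 * ‖z‖)] with R hR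
    simp only [hq]
    exact norm_integral_dslope_mul_inv_le hc hd hb hz hR
  exact tendsto_nhds_unique h1 h2

lemma integral_im_mul_poissonKernel (hc : ContinuousOn f {z | 0 ≤ z.im})
    (hd : DifferentiableOn ℂ f {z | 0 < z.im}) (hb : ∀ z : ℂ, 0 ≤ z.im → ‖f z‖ ≤ C)
    {z : ℂ} (hz : 0 < z.im) :
    ∫ x : ℝ, (f x).im * ‖(z - (x : ℂ))⁻¹‖ ^ 2 = (f z).im * (Real.pi / z.im) := by
  have hcx : Continuous fun x : ℝ => f x :=
    hc.comp_continuous Complex.continuous_ofReal fun x => by simp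
  have hint : Integrable fun x : ℝ => (f x - f z) * ((‖(z - (x : ℂ))⁻¹‖ ^ 2 : ℝ) : ℂ) := by
    refine (integrable_poissonKernel hz).ofReal.bdd_mul (c := C + C)
      (hcx.sub continuous_const).aestronglyMeasurable (ae_of_all _ fun x => ?_)
    exact (norm_sub_le _ _).trans (add_le_add (hb _ (by simp)) (hb _ hz.le))
  have hint2 : Integrable fun x : ℝ => (f x).im * ‖(z - (x : ℂ))⁻¹‖ ^ 2 := by
    refine (integrable_poissonKernel hz).bdd_mul (c := C)
      (Complex.continuous_im.comp hcx).aestronglyMeasurable (ae_of_all _ fun x => ?_)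
    exact (Complex.abs_im_le_norm _).trans (hb _ (by simp))
  have h := congrArg Complex.im (integral_sub_mul_poissonKernel hc hd hb hz)
  have h2 := integral_im hint
  simp only [RCLike.im_to_complex] at h2
  rw [← h2, Complex.zero_im] at h
  simp only [Complex.im_mul_ofReal, Complex.sub_im, sub_mul] at h
  rw [integral_sub hint2 ((integrable_poissonKernel hz).const_mul _), integral_const_mul,
    integral_poissonKernel hz] at h
  linarith

end Poisson

/-! ### Existence of the free convolution -/

section Existence

variable {ν : Measure ℝ} [IsProbabilityMeasure ν] {M : ℝ}

lemma norm_sub_subordination_le {z : ℂ} (hz : 0 ≤ z.im) : ‖z - subordination ν 1 z‖ ≤ 1 := by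
  rw [← stieltjes_subordination hz]
  exact norm_stieltjes_le_one (subordination_mem hz).2

/-- If w = ω(x) had Im w > 0, H(w) real would force ∫ |w - y|⁻² dν = 1. But |x - w| ≤ 1 keeps Re w
at distance at least 1 from almost every y, so the integral is below 1. -/
lemma subordination_im_eq_zero (hM : ∀ᵐ y ∂ν, |y| ≤ M) {x : ℝ} (hx : M + 2 ≤ |x|) :
    (subordination ν 1 x).im = 0 := by
  set w := subordination ν 1 (x : ℂ) with hw
  have hmem : w ∈ bianeClosure ν := subordination_mem (by simp)
  by_contra hne
  have hpos : 0 < w.im := lt_of_le_of_ne hmem.1 (Ne.symm hne)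
  have h1 : (bianeH ν 1 w).im = 0 := by
    rw [hw, bianeH_subordination (by simp)]
    simp
  rw [bianeH_im hne, mul_eq_zero, or_iff_right hne, sub_eq_zero] at h1
  have h2 : |x - w.re| ≤ 1 := by
    have := (Complex.abs_re_le_norm _).trans
      (norm_sub_subordination_le (ν := ν) (z := (x : ℂ)) (by simp))
    simpa using this
  have h3 : ∀ᵐ y : ℝ ∂ν, ‖(w - (y : ℂ))⁻¹‖ ^ 2 ≤ (1 + w.im ^ 2)⁻¹ := by
    filter_upwards [hM] with y hy
    rw [norm_inv, inv_pow, ← sq_add_sq_eq_norm_sub_sq]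
    have h4 : 1 ≤ |y - w.re| := by
      have h5 := abs_sub_abs_le_abs_sub x (x - w.re + y)
      have h6 := abs_add_le (x - w.re) y
      have h7 : x - (x - w.re + y) = -(y - w.re) := by ring
      rw [h7, abs_neg] at h5
      linarith
    have h8 : 1 ≤ (y - w.re) ^ 2 := by
      rw [← sq_abs]
      nlinarith
    gcongr
  have h9 : ∫ y : ℝ, ‖(w - (y : ℂ))⁻¹‖ ^ 2 ∂ν ≤ (1 + w.im ^ 2)⁻¹ := by
    have := integral_mono_ae
      (integrable_norm_inv_sq (ne_top_of_mem_bianeClosure hmem)) (integrable_const _) h3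
    simpa using this
  rw [← h1] at h9
  have h10 : (1 + w.im ^ 2)⁻¹ < 1 := inv_lt_one_of_one_lt₀ (by nlinarith)
  linarith

lemma norm_stieltjes_subordination_le {z : ℂ} (hz : 0 < z.im) :
    ‖stieltjes ν (subordination ν 1 z)‖ ≤ z.im⁻¹ := by
  have h1 := im_le_im_subordination (ν := ν) hz
  have h2 := norm_stieltjes_le (m := ν) (hz.trans_le h1).ne'
  rw [probReal_univ, mul_one, abs_of_pos (hz.trans_le h1)] at h2
  exact h2.trans (inv_anti₀ hz h1)

lemma norm_mul_stieltjes_subordination_sub_one_le (hM : ∀ᵐ y ∂ν, |y| ≤ M) {z : ℂ}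
    (hz : 0 < z.im) :
    ‖z * stieltjes ν (subordination ν 1 z) - 1‖ ≤ M * z.im⁻¹ + z.im⁻¹ ^ 2 := by
  have hM0 : 0 ≤ M := by
    obtain ⟨y, hy⟩ := hM.exists
    exact (abs_nonneg y).trans hy
  set w := subordination ν 1 z with hw
  have h1 : z.im ≤ w.im := im_le_im_subordination (ν := ν) hz
  have h2 := norm_mul_stieltjes_sub_le hM (hz.trans_le h1).ne'
  rw [probReal_univ, mul_one, abs_of_pos (hz.trans_le h1), Complex.ofReal_one] at h2
  -- Substitute z = w + G_ν(w).
  have h3 : z * stieltjes ν w - 1 = (w * stieltjes ν w - 1) + stieltjes ν w ^ 2 := by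
    linear_combination (-stieltjes ν w) * (stieltjes_subordination (ν := ν) hz.le)
  rw [h3]
  refine (norm_add_le _ _).trans (add_le_add (h2.trans ?_) ?_)
  · exact mul_le_mul_of_nonneg_left (inv_anti₀ hz h1) hM0
  · rw [norm_pow]
    exact pow_le_pow_left₀ (norm_nonneg _) (norm_stieltjes_subordination_le hz) 2

/-- The density of the free convolution with the semicircular law of variance `1`. -/
noncomputable def freeDensity (ν : Measure ℝ) (x : ℝ) : ℝ := (subordination ν 1 x).im / Real.pi

lemma freeDensity_nonneg (x : ℝ) : 0 ≤ freeDensity ν x :=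
  div_nonneg (subordination_mem (by simp)).1 Real.pi_pos.le

lemma continuous_freeDensity : Continuous (freeDensity ν) := by
  refine Continuous.div_const (Complex.continuous_im.comp ?_) _
  exact continuousOn_subordination.comp_continuous Complex.continuous_ofReal fun x => by simp

lemma freeDensity_eq_zero (hM : ∀ᵐ y ∂ν, |y| ≤ M) {x : ℝ} (hx : M + 2 ≤ |x|) :
    freeDensity ν x = 0 := by
  rw [freeDensity, subordination_im_eq_zero hM hx, zero_div]

lemma integrable_freeDensity (hM : ∀ᵐ y ∂ν, |y| ≤ M) : Integrable (freeDensity ν) := by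
  refine continuous_freeDensity.integrable_of_hasCompactSupport ?_
  refine HasCompactSupport.of_support_subset_isCompact (isCompact_Icc (a := -(M + 2)) (b := M + 2))
    fun x hx => ?_
  by_contra h
  refine hx (freeDensity_eq_zero hM ?_)
  rw [mem_Icc, ← abs_le, not_le] at h
  exact h.le

/-- The measure with density `freeDensity ν`. -/
noncomputable def freeMeasure (ν : Measure ℝ) : Measure ℝ :=
  volume.withDensity fun x => ENNReal.ofReal (freeDensity ν x)

lemma isFiniteMeasure_freeMeasure (hM : ∀ᵐ y ∂ν, |y| ≤ M) : IsFiniteMeasure (freeMeasure ν) :=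
  isFiniteMeasure_withDensity_ofReal (integrable_freeDensity hM).2

/-- The function z - ω(z) = G_ν(ω(z)) is bounded by 1 and has boundary imaginary part -π times the
density; apply the Poisson formula. -/
lemma stieltjes_freeMeasure_im (hM : ∀ᵐ y ∂ν, |y| ≤ M) {z : ℂ} (hz : 0 < z.im) :
    (stieltjes (freeMeasure ν) z).im = (stieltjes ν (subordination ν 1 z)).im := by
  have := isFiniteMeasure_freeMeasure hM
  have hcs : ContinuousOn (fun z => z - subordination ν 1 z) {z | 0 ≤ z.im} :=
    continuousOn_id.sub continuousOn_subordination
  have hds : DifferentiableOn ℂ (fun z => z - subordination ν 1 z) {z | 0 < z.im} :=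
    differentiableOn_id.sub differentiableOn_subordination
  have hP := integral_im_mul_poissonKernel hcs hds
    (fun z hz => norm_sub_subordination_le (ν := ν) hz) hz
  rw [stieltjes_im (notMem_image_support_of_im_ne hz.ne'), stieltjes_subordination hz.le,
    freeMeasure, integral_withDensity_eq_integral_toReal_smul
      (continuous_freeDensity.measurable.ennreal_ofReal) (ae_of_all _ fun x => by simp)]
  have h1 : ∫ x : ℝ, ((x : ℂ) - subordination ν 1 x).im * ‖(z - (x : ℂ))⁻¹‖ ^ 2 =
      -Real.pi * ∫ x : ℝ, (ENNReal.ofReal (freeDensity ν x)).toReal • ‖(z - (x : ℂ))⁻¹‖ ^ 2 := by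
    rw [← integral_const_mul]
    congr 1 with x
    rw [ENNReal.toReal_ofReal (freeDensity_nonneg x), freeDensity, Complex.sub_im,
      Complex.ofReal_im, smul_eq_mul]
    field_simp
    ring
  rw [h1] at hP
  generalize ∫ x : ℝ, (ENNReal.ofReal (freeDensity ν x)).toReal • ‖(z - (x : ℂ))⁻¹‖ ^ 2 = J
    at hP ⊢
  have hpi := Real.pi_pos.ne'
  have hz' := hz.ne'
  field_simp at hP
  linarith

/-- The difference is holomorphic with zero imaginary part, hence constant by the open mapping
theorem; it decays along the imaginary axis, so the constant is 0. -/
lemma stieltjes_freeMeasure (hM : ∀ᵐ y ∂ν, |y| ≤ M) {z : ℂ} (hz : 0 < z.im) :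
    stieltjes (freeMeasure ν) z = stieltjes ν (subordination ν 1 z) := by
  have := isFiniteMeasure_freeMeasure hM
  set g : ℂ → ℂ := fun z => stieltjes (freeMeasure ν) z - (z - subordination ν 1 z) with hg
  have hgz : ∀ z : ℂ, 0 < z.im →
      g z = stieltjes (freeMeasure ν) z - stieltjes ν (subordination ν 1 z) := fun z hz => by
    rw [stieltjes_subordination hz.le]
  have hd : DifferentiableOn ℂ g {z | 0 < z.im} :=
    differentiableOn_stieltjes.sub (differentiableOn_id.sub differentiableOn_subordination)
  have hzero : ∀ z : ℂ, 0 < z.im → (g z).im = 0 := fun z hz => by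
    rw [hgz z hz, Complex.sub_im, stieltjes_freeMeasure_im hM hz, sub_self]
  have hconst : ∃ c, ∀ z ∈ {z : ℂ | 0 < z.im}, g z = c := by
    refine ((hd.analyticOnNhd isOpen_upperHalfPlane).is_constant_or_isOpen
      (convex_halfSpace_im_gt 0).isPreconnected).resolve_right fun h => ?_
    have ho := h _ subset_rfl isOpen_upperHalfPlane
    have hI : g Complex.I ∈ g '' {z : ℂ | 0 < z.im} := ⟨Complex.I, by simp, rfl⟩
    have ht : Tendsto (fun ε : ℝ => g Complex.I + ε * Complex.I) (𝓝[>] 0) (𝓝 (g Complex.I)) := by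
      have : ContinuousAt (fun ε : ℝ => g Complex.I + ε * Complex.I) 0 := by fun_prop
      simpa using this.tendsto.mono_left (nhdsWithin_le_nhds (s := Ioi (0 : ℝ)))
    obtain ⟨ε, ⟨w, hw, hwε⟩, hε⟩ :=
      ((ht.eventually (ho.mem_nhds hI)).and self_mem_nhdsWithin).exists
    have h1 := congrArg Complex.im hwε
    rw [hzero w hw] at h1
    simp only [Complex.add_im, Complex.mul_im, Complex.ofReal_re, Complex.I_im, mul_one,
      Complex.ofReal_im, Complex.I_re, mul_zero, add_zero, hzero Complex.I (by simp)] at h1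
    have hε : 0 < ε := hε
    linarith
  obtain ⟨c, hc⟩ := hconst
  have hc0 : c = 0 := by
    have hle : ∀ᶠ y : ℝ in atTop, ‖c‖ ≤ y⁻¹ * ((freeMeasure ν).real univ + 1) := by
      filter_upwards [eventually_gt_atTop 0] with y hy
      have him : ((y : ℂ) * Complex.I).im = y := by simp
      have hpos : 0 < ((y : ℂ) * Complex.I).im := him.symm ▸ hy
      rw [← hc _ hpos, hgz _ hpos]
      have h1 := norm_stieltjes_le (m := freeMeasure ν) hpos.ne'
      have h2 := norm_stieltjes_subordination_le (ν := ν) hpos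
      rw [him] at h1 h2
      rw [abs_of_pos hy] at h1
      linarith [norm_sub_le (stieltjes (freeMeasure ν) ((y : ℂ) * Complex.I))
        (stieltjes ν (subordination ν 1 ((y : ℂ) * Complex.I)))]
    have hlim := (tendsto_inv_atTop_zero (𝕜 := ℝ)).mul_const ((freeMeasure ν).real univ + 1)
    rw [zero_mul] at hlim
    exact norm_le_zero_iff.1 (ge_of_tendsto hlim hle)
  have := hc z hz
  rw [hgz z hz, hc0] at this
  exact sub_eq_zero.1 this

/-- Along z = iy, zG(z) tends to the total mass, and z G_ν(ω(z)) tends to 1. -/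
lemma isProbabilityMeasure_freeMeasure (hM : ∀ᵐ y ∂ν, |y| ≤ M) :
    IsProbabilityMeasure (freeMeasure ν) := by
  have := isFiniteMeasure_freeMeasure hM
  have hM' : ∀ᵐ y ∂freeMeasure ν, |y| ≤ M + 2 := by
    rw [freeMeasure, ae_withDensity_iff continuous_freeDensity.measurable.ennreal_ofReal]
    refine ae_of_all _ fun x hx => ?_
    by_contra h
    exact hx (by rw [freeDensity_eq_zero hM (not_le.1 h).le, ENNReal.ofReal_zero])
  set a := (freeMeasure ν).real univ
  have hle : ∀ᶠ y : ℝ in atTop, ‖(a : ℂ) - 1‖ ≤ (M + 2) * y⁻¹ * a + (M * y⁻¹ + y⁻¹ ^ 2) := by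
    filter_upwards [eventually_gt_atTop 0] with y hy
    have him : ((y : ℂ) * Complex.I).im = y := by simp
    have hpos : 0 < ((y : ℂ) * Complex.I).im := him.symm ▸ hy
    have h1 := norm_mul_stieltjes_sub_le hM' hpos.ne'
    have h2 := norm_mul_stieltjes_subordination_sub_one_le hM hpos
    rw [stieltjes_freeMeasure hM hpos, norm_sub_rev] at h1
    rw [him] at h1 h2
    rw [abs_of_pos hy] at h1
    refine le_trans ?_ ((norm_add_le _ _).trans (add_le_add h1 h2))
    refine le_of_eq (congrArg _ ?_)
    ring
  have hlim : Tendsto (fun y : ℝ => (M + 2) * y⁻¹ * a + (M * y⁻¹ + y⁻¹ ^ 2)) atTop (𝓝 0) := by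
    have h := tendsto_inv_atTop_zero (𝕜 := ℝ)
    have := ((h.const_mul (M + 2)).mul_const a).add ((h.const_mul M).add (h.pow 2))
    simpa using this
  have h0 : (a : ℂ) - 1 = 0 := norm_le_zero_iff.1 (ge_of_tendsto hlim hle)
  have h1 : a = 1 := by exact_mod_cast sub_eq_zero.1 h0
  exact ⟨by rwa [← ENNReal.toReal_eq_one_iff]⟩

/-- Existence gives the ε-choice its two defining properties. Only these are used afterwards, so
uniqueness is not needed. -/
lemma freeConvSemicircle_spec (hM : ∀ᵐ y ∂ν, |y| ≤ M) :
    IsProbabilityMeasure (freeConvSemicircle ν 1) ∧ ∀ z : ℂ, 0 < z.im →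
      stieltjes (freeConvSemicircle ν 1) z = stieltjes ν (subordination ν 1 z) :=
  Classical.epsilon_spec (p := fun μ : Measure ℝ => IsProbabilityMeasure μ ∧
    ∀ z : ℂ, 0 < z.im → stieltjes μ z = stieltjes ν (subordination ν 1 z))
    ⟨freeMeasure ν, isProbabilityMeasure_freeMeasure hM, fun _ hz => stieltjes_freeMeasure hM hz⟩

end Existence

/-! ### Locating the support through the distribution function -/

section Cdf

open ProbabilityTheory

variable {m : Measure ℝ} [IsProbabilityMeasure m]

/-- Mass o(r) in intervals of radius r means that the distribution function has derivative 0. This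
stands in for Stieltjes inversion. -/
lemma cdf_eq_of_measureReal_Icc_le {s : Set ℝ} (hs : IsOpen s) (hpre : IsPreconnected s)
    (h : ∀ x ∈ s, ∀ ε > 0, ∀ᶠ r in 𝓝[>] (0 : ℝ), m.real (Icc (x - r) (x + r)) ≤ ε * r)
    {x y : ℝ} (hx : x ∈ s) (hy : y ∈ s) : cdf m x = cdf m y := by
  have hd : ∀ x ∈ s, HasDerivAt (cdf m) 0 x := by
    intro x hx
    rw [hasDerivAt_iff_isLittleO, Asymptotics.isLittleO_iff]
    intro ε hε
    have h1 := eventually_nhdsWithin_iff.1 (h x hx ε hε)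
    have ht : Tendsto (fun x' : ℝ => |x' - x|) (𝓝 x) (𝓝 0) := by
      have : ContinuousAt (fun x' : ℝ => |x' - x|) x := by fun_prop
      simpa [ContinuousAt] using this
    filter_upwards [ht.eventually h1] with x' hx'
    rcases eq_or_ne x' x with rfl | hne
    · simp
    have h2 := hx' (abs_pos.2 (sub_ne_zero.2 hne))
    rw [smul_zero, sub_zero, Real.norm_eq_abs, Real.norm_eq_abs]
    refine le_trans ?_ h2
    have key : ∀ a b : ℝ, a ≤ b → |cdf m b - cdf m a| ≤ m.real (Icc a b) := by
      intro a b hab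
      rw [cdf_eq_real, cdf_eq_real, ← Iic_union_Ioc_eq_Iic hab,
        measureReal_union (Iic_disjoint_Ioc le_rfl) measurableSet_Ioc, add_sub_cancel_left,
        abs_of_nonneg measureReal_nonneg]
      exact measureReal_mono Ioc_subset_Icc_self
    rcases le_total x x' with hle | hle
    · refine (key _ _ hle).trans (measureReal_mono (Icc_subset_Icc ?_ ?_))
      · linarith [abs_nonneg (x' - x)]
      · linarith [le_abs_self (x' - x)]
    · rw [abs_sub_comm]
      refine (key _ _ hle).trans (measureReal_mono (Icc_subset_Icc ?_ ?_))
      · linarith [neg_abs_le (x' - x)]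
      · linarith [abs_nonneg (x' - x)]
  exact hs.is_const_of_deriv_eq_zero hpre
    (fun z hz => (hd z hz).differentiableAt.differentiableWithinAt)
    (fun z hz => (hd z hz).deriv) hx hy

/-- At z = x + ir the kernel |z - y|⁻² is at least 1/(2r²) on the interval. -/
lemma measureReal_Icc_le_stieltjes (x : ℝ) {r : ℝ} (hr : 0 < r) :
    m.real (Icc (x - r) (x + r)) ≤ 2 * |(stieltjes m (x + r * Complex.I)).im| * r := by
  set z : ℂ := x + r * Complex.I with hz
  have him : z.im = r := by simp [hz]
  have hre : z.re = x := by simp [hz]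
  have hne : z.im ≠ 0 := him ▸ hr.ne'
  have hI : Integrable (fun y : ℝ => ‖(z - (y : ℂ))⁻¹‖ ^ 2) m := by
    refine Integrable.of_bound ((aestronglyMeasurable_inv_sub m z).norm.pow 2) (|z.im|⁻¹ ^ 2)
      (ae_of_all _ fun y => ?_)
    rw [norm_pow, norm_norm]
    exact pow_le_pow_left₀ (norm_nonneg _) (norm_inv_sub_le hne y) 2
  have h1 : m.real (Icc (x - r) (x + r)) * (2 * r ^ 2)⁻¹ ≤
      ∫ y : ℝ, ‖(z - (y : ℂ))⁻¹‖ ^ 2 ∂m := by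
    rw [← smul_eq_mul, ← setIntegral_const]
    refine le_trans (setIntegral_mono_on (integrable_const _).integrableOn hI.integrableOn
      measurableSet_Icc fun y hy => ?_)
      (setIntegral_le_integral hI (ae_of_all _ fun y => by positivity))
    rw [norm_inv, inv_pow, ← sq_add_sq_eq_norm_sub_sq, him, hre]
    have : (y - x) ^ 2 ≤ r ^ 2 := sq_le_sq' (by linarith [hy.1]) (by linarith [hy.2])
    have h0 : 0 < (y - x) ^ 2 + r ^ 2 := by positivity
    exact inv_anti₀ h0 (by linarith)
  rw [stieltjes_im (notMem_image_support_of_im_ne hne), abs_neg, him,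
    abs_of_nonneg (mul_nonneg hr.le (integral_nonneg fun y => by positivity))]
  rw [mul_inv_le_iff₀ (by positivity)] at h1
  linarith

lemma eventually_measureReal_Icc_le {x : ℝ}
    (h : Tendsto (fun r : ℝ => (stieltjes m (x + r * Complex.I)).im) (𝓝[>] 0) (𝓝 0))
    {ε : ℝ} (hε : 0 < ε) : ∀ᶠ r in 𝓝[>] (0 : ℝ), m.real (Icc (x - r) (x + r)) ≤ ε * r := by
  have h1 := h.abs
  rw [abs_zero] at h1
  filter_upwards [h1.eventually (gt_mem_nhds (half_pos hε)), self_mem_nhdsWithin] with r h2 hr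
  have hr : 0 < r := hr
  refine (measureReal_Icc_le_stieltjes x hr).trans ?_
  exact mul_le_mul_of_nonneg_right (by linarith) hr.le

lemma measureReal_Icc_le_sq {x : ℝ} (h : sqPotential m x ≤ 1) (r : ℝ) (hr : 0 < r) :
    m.real (Icc (x - r) (x + r)) ≤ r ^ 2 := by
  have hI := integrable_norm_inv_sq (h.trans_lt ENNReal.one_lt_top).ne
  have hne := ae_ne_of_sqPotential_ne_top (h.trans_lt ENNReal.one_lt_top).ne
  have h1 : m.real (Icc (x - r) (x + r)) * (r ^ 2)⁻¹ ≤
      ∫ y : ℝ, ‖((x : ℂ) - (y : ℂ))⁻¹‖ ^ 2 ∂m := by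
    rw [← smul_eq_mul, ← setIntegral_const]
    refine le_trans (setIntegral_mono_on_ae (integrable_const _).integrableOn hI.integrableOn
      measurableSet_Icc ?_) (setIntegral_le_integral hI (ae_of_all _ fun y => by positivity))
    filter_upwards [hne] with y hy hyI
    rw [norm_inv, inv_pow, ← sq_add_sq_eq_norm_sub_sq]
    have hyx : y - x ≠ 0 := sub_ne_zero.2 fun h => hy (by rw [h])
    simp only [Complex.ofReal_re, Complex.ofReal_im, ne_eq, OfNat.ofNat_ne_zero,
      not_false_eq_true, zero_pow, add_zero]
    have : (y - x) ^ 2 ≤ r ^ 2 := sq_le_sq' (by linarith [hyI.1]) (by linarith [hyI.2])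
    exact inv_anti₀ (by positivity) this
  rw [mul_inv_le_iff₀ (by positivity)] at h1
  nlinarith [integral_norm_inv_sq_le h, sq_nonneg r]

lemma support_subset_Ici_of_cdf {a : ℝ}
    (h : ∀ x < a, ∀ ε > 0, ∀ᶠ r in 𝓝[>] (0 : ℝ), m.real (Icc (x - r) (x + r)) ≤ ε * r) :
    m.support ⊆ Ici a := by
  have hcdf : ∀ x < a, cdf m x = 0 := by
    intro x hx
    have h1 : ∀ᶠ y in atBot, cdf m y = cdf m x := by
      filter_upwards [eventually_lt_atBot a] with y hy
      exact cdf_eq_of_measureReal_Icc_le isOpen_Iio isPreconnected_Iio h hy hx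
    exact tendsto_nhds_unique ((tendsto_congr' h1).2 tendsto_const_nhds) (tendsto_cdf_atBot m)
  intro x hx
  by_contra hxa
  rw [mem_Ici, not_le] at hxa
  obtain ⟨x', h1, h2⟩ := exists_between hxa
  have h3 := (Measure.mem_support_iff_forall x).1 hx _ (Iic_mem_nhds h1)
  have h4 := hcdf x' h2
  rw [cdf_eq_real, measureReal_eq_zero_iff] at h4
  exact h3.ne' h4

lemma support_subset_Iic_of_cdf {a : ℝ}
    (h : ∀ x > a, ∀ ε > 0, ∀ᶠ r in 𝓝[>] (0 : ℝ), m.real (Icc (x - r) (x + r)) ≤ ε * r) :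
    m.support ⊆ Iic a := by
  have hcdf : ∀ x > a, cdf m x = 1 := by
    intro x hx
    have h1 : ∀ᶠ y in atTop, cdf m y = cdf m x := by
      filter_upwards [eventually_gt_atTop a] with y hy
      exact cdf_eq_of_measureReal_Icc_le isOpen_Ioi isPreconnected_Ioi h hy hx
    exact tendsto_nhds_unique ((tendsto_congr' h1).2 tendsto_const_nhds) (tendsto_cdf_atTop m)
  intro x hx
  by_contra hxa
  rw [mem_Iic, not_le] at hxa
  obtain ⟨x', h1, h2⟩ := exists_between hxa
  have h3 := (Measure.mem_support_iff_forall x).1 hx _ (Ioi_mem_nhds h2)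
  have h4 := hcdf x' h1
  rw [cdf_eq_real] at h4
  have h5 := probReal_compl_eq_one_sub (μ := m) (measurableSet_Iic (a := x'))
  rw [h4, sub_self, compl_Iic, measureReal_eq_zero_iff] at h5
  exact h3.ne' h5

end Cdf

/-! ### Edges of a compact support -/

section Edges

variable {m : Measure ℝ}

lemma leftEdge_mem [IsProbabilityMeasure m] (hm : IsCompact m.support) : leftEdge m ∈ m.support :=
  hm.sInf_mem (Measure.nonempty_support (IsProbabilityMeasure.ne_zero m))

lemma leftEdge_le (hm : IsCompact m.support) {y : ℝ} (hy : y ∈ m.support) : leftEdge m ≤ y :=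
  csInf_le hm.bddBelow hy

lemma le_rightEdge (hm : IsCompact m.support) {y : ℝ} (hy : y ∈ m.support) : y ≤ rightEdge m :=
  le_csSup hm.bddAbove hy

lemma leftEdge_le_rightEdge [IsProbabilityMeasure m] (hm : IsCompact m.support) : leftEdge m ≤ rightEdge m :=
  le_rightEdge hm (leftEdge_mem hm)

lemma ae_leftEdge_le (hm : IsCompact m.support) : ∀ᵐ y ∂m, leftEdge m ≤ y := by
  filter_upwards [Measure.support_mem_ae (μ := m)] with y hy using leftEdge_le hm hy

lemma ae_le_rightEdge (hm : IsCompact m.support) : ∀ᵐ y ∂m, y ≤ rightEdge m := by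
  filter_upwards [Measure.support_mem_ae (μ := m)] with y hy using le_rightEdge hm hy

lemma notMem_support_of_lt (hm : IsCompact m.support) {x : ℝ} (hx : x < leftEdge m) :
    x ∉ m.support := fun h => (leftEdge_le hm h).not_gt hx

lemma exists_ae_abs_le (hm : IsCompact m.support) : ∃ M : ℝ, ∀ᵐ y ∂m, |y| ≤ M := by
  obtain ⟨M, hM⟩ := hm.isBounded.exists_norm_le
  refine ⟨M, ?_⟩
  filter_upwards [Measure.support_mem_ae (μ := m)] with y hy using hM y hy

end Edges

/-! ### The critical point and the increasing branch of H -/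

section Critical

/-- The largest point `c ≤ leftEdge ν` with `∫ (c - y)⁻² dν(y) ≤ 1`. -/
noncomputable def criticalPoint (ν : Measure ℝ) : ℝ :=
  sSup {u : ℝ | u ≤ leftEdge ν ∧ (u : ℂ) ∈ bianeClosure ν}

variable {ν : Measure ℝ}

lemma le_criticalPoint {u : ℝ} (hu : u ≤ leftEdge ν) (h : (u : ℂ) ∈ bianeClosure ν) :
    u ≤ criticalPoint ν :=
  le_csSup ⟨leftEdge ν, fun _ h => h.1⟩ ⟨hu, h⟩

variable [IsProbabilityMeasure ν]

lemma criticalPoint_mem (hν : IsCompact ν.support) :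
    criticalPoint ν ≤ leftEdge ν ∧ (criticalPoint ν : ℂ) ∈ bianeClosure ν := by
  have hcl : IsClosed {u : ℝ | u ≤ leftEdge ν ∧ (u : ℂ) ∈ bianeClosure ν} :=
    isClosed_Iic.inter ((isClosed_bianeClosure ν).preimage Complex.continuous_ofReal)
  -- At distance at least 1 from the support the kernel is at most 1.
  refine hcl.csSup_mem ⟨leftEdge ν - 1, by linarith, by simp, ?_⟩ ⟨leftEdge ν, fun _ h => h.1⟩
  refine sqPotential_le_one_of_dist ?_
  filter_upwards [ae_leftEdge_le hν] with y hy
  simp only [Complex.ofReal_re, Complex.ofReal_im]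
  nlinarith

lemma ofReal_mem_bianeClosure (hν : IsCompact ν.support) {u : ℝ} (hu : u ≤ criticalPoint ν) :
    (u : ℂ) ∈ bianeClosure ν := by
  obtain ⟨h1, h2⟩ := criticalPoint_mem hν
  refine ⟨by simp, le_trans (lintegral_mono_ae ?_) h2.2⟩
  filter_upwards [ae_leftEdge_le hν] with y hy
  simp only [Complex.ofReal_re, Complex.ofReal_im]
  gcongr ?_⁻¹
  refine ENNReal.ofReal_le_ofReal ?_
  nlinarith

/-- Monotone because G is 1-Lipschitz, strict because H is injective; no derivative is needed, so w
= c = ℓ is covered. -/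
lemma bianeHReal_lt (hν : IsCompact ν.support) {u w : ℝ} (huw : u < w)
    (hw : w ≤ criticalPoint ν) : bianeHReal ν 1 u < bianeHReal ν 1 w := by
  have hu' := ofReal_mem_bianeClosure hν (huw.le.trans hw)
  have hw' := ofReal_mem_bianeClosure hν hw
  refine lt_of_le_of_ne ?_ fun h => huw.ne ?_
  · have h := norm_stieltjes_sub_le hw'.2 hu'.2
    rw [stieltjes_ofReal, stieltjes_ofReal, ← Complex.ofReal_sub, ← Complex.ofReal_sub,
      Complex.norm_real, Complex.norm_real, Real.norm_eq_abs, Real.norm_eq_abs,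
      abs_of_pos (sub_pos.2 huw)] at h
    rw [bianeHReal_one, bianeHReal_one]
    linarith [(abs_le.1 h).1]
  · have := injOn_bianeH hu' hw' (by rw [bianeH_ofReal, bianeH_ofReal, h])
    exact_mod_cast this

lemma continuousOn_stieltjesReal (hν : IsCompact ν.support) :
    ContinuousOn (stieltjesReal ν) (Iic (criticalPoint ν)) := by
  have h : ContinuousOn (fun u : ℝ => (stieltjes ν u).re) (Iic (criticalPoint ν)) :=
    Complex.continuous_re.comp_continuousOn (continuousOn_stieltjes.comp
      Complex.continuous_ofReal.continuousOn fun u hu => ofReal_mem_bianeClosure hν hu)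
  exact h.congr fun u _ => (congrArg Complex.re (stieltjes_ofReal ν u)).symm

lemma continuousOn_bianeHReal (hν : IsCompact ν.support) :
    ContinuousOn (bianeHReal ν 1) (Iic (criticalPoint ν)) := by
  simp only [funext bianeHReal_one]
  exact continuousOn_id.add (continuousOn_stieltjesReal hν)

lemma abs_stieltjesReal_le_one {u : ℝ} (hu : (u : ℂ) ∈ bianeClosure ν) :
    |stieltjesReal ν u| ≤ 1 := by
  have h := norm_stieltjes_le_one hu.2
  rwa [stieltjes_ofReal, Complex.norm_real] at h

lemma exists_bianeHReal_eq (hν : IsCompact ν.support) {x : ℝ}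
    (hx : x ≤ bianeHReal ν 1 (criticalPoint ν)) : ∃ u ≤ criticalPoint ν, bianeHReal ν 1 u = x := by
  -- Since |G| ≤ 1 on this half-line, H(u₁) ≤ u₁ + 1 ≤ x.
  set u₁ := min (criticalPoint ν) (x - 1)
  have h1 : u₁ ≤ criticalPoint ν := min_le_left _ _
  have h2 : bianeHReal ν 1 u₁ ≤ x := by
    rw [bianeHReal_one]
    have := (abs_le.1 (abs_stieltjesReal_le_one (ofReal_mem_bianeClosure hν h1))).2
    linarith [min_le_right (criticalPoint ν) (x - 1)]
  obtain ⟨u, hu, rfl⟩ := intermediate_value_Icc h1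
    ((continuousOn_bianeHReal hν).mono Icc_subset_Iic_self) ⟨h2, hx⟩
  exact ⟨u, hu.2, rfl⟩

lemma subordination_bianeHReal (hν : IsCompact ν.support) {u : ℝ} (hu : u ≤ criticalPoint ν) :
    subordination ν 1 (bianeHReal ν 1 u : ℂ) = u := by
  rw [← bianeH_ofReal]
  exact subordination_bianeH (ofReal_mem_bianeClosure hν hu)

lemma subordinationReal_bianeHReal (hν : IsCompact ν.support) {u : ℝ}
    (hu : u ≤ criticalPoint ν) : subordinationReal ν 1 (bianeHReal ν 1 u) = u := by
  rw [subordinationReal, subordination_bianeHReal hν hu, Complex.ofReal_re]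

end Critical

/-! ### The left edge of the free convolution -/

section FreeEdge

variable {ν μ : Measure ℝ} [IsProbabilityMeasure ν]

lemma tendsto_stieltjes_vertical
    (hμ : ∀ z : ℂ, 0 < z.im → stieltjes μ z = stieltjes ν (subordination ν 1 z)) (x : ℝ) :
    Tendsto (fun r : ℝ => stieltjes μ (x + r * Complex.I)) (𝓝[>] 0)
      (𝓝 (x - subordination ν 1 x)) := by
  have h1 : Tendsto (fun r : ℝ => (x : ℂ) + r * Complex.I) (𝓝[>] 0) (𝓝[{z | 0 ≤ z.im}] x) := by
    refine tendsto_nhdsWithin_iff.2 ⟨?_, ?_⟩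
    · have : ContinuousAt (fun r : ℝ => (x : ℂ) + r * Complex.I) 0 := by fun_prop
      simpa using this.tendsto.mono_left (nhdsWithin_le_nhds (s := Ioi (0 : ℝ)))
    · filter_upwards [self_mem_nhdsWithin] with r hr
      have hr : 0 < r := hr
      simpa using hr.le
  have h2 : ContinuousWithinAt (fun z : ℂ => z - subordination ν 1 z) {z | 0 ≤ z.im} x :=
    (continuousOn_id.sub continuousOn_subordination) x (by simp)
  refine (h2.tendsto.comp h1).congr' ?_
  filter_upwards [self_mem_nhdsWithin] with r hr
  have hr : 0 < r := hr
  have hp : 0 < ((x : ℂ) + r * Complex.I).im := by simpa using hr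
  rw [hμ _ hp, stieltjes_subordination hp.le]
  rfl

variable [IsProbabilityMeasure μ]

lemma stieltjes_eq_of_notMem_support
    (hμ : ∀ z : ℂ, 0 < z.im → stieltjes μ z = stieltjes ν (subordination ν 1 z)) {x : ℝ}
    (hx : x ∉ μ.support) : stieltjes μ x = x - subordination ν 1 x := by
  refine tendsto_nhds_unique ?_ (tendsto_stieltjes_vertical hμ x)
  have h1 : ContinuousAt (fun r : ℝ => (x : ℂ) + r * Complex.I) 0 := by fun_prop
  have h2 := (hasDerivAt_stieltjes (m := μ) (ofReal_notMem_image_support hx)).continuousAt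
  have h3 := h2.tendsto.comp (f := fun r : ℝ => (x : ℂ) + r * Complex.I)
    (x := 𝓝[>] (0 : ℝ)) (by simpa using h1.tendsto.mono_left (nhdsWithin_le_nhds))
  exact h3

lemma eventually_measureReal_le_of_subordination_im_eq_zero
    (hμ : ∀ z : ℂ, 0 < z.im → stieltjes μ z = stieltjes ν (subordination ν 1 z)) {x : ℝ}
    (hx : (subordination ν 1 x).im = 0) (ε : ℝ) (hε : 0 < ε) :
    ∀ᶠ r in 𝓝[>] (0 : ℝ), μ.real (Icc (x - r) (x + r)) ≤ ε * r := by
  refine eventually_measureReal_Icc_le ?_ hε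
  have := (Complex.continuous_im.tendsto _).comp (tendsto_stieltjes_vertical hμ x)
  rw [Complex.sub_im, hx, Complex.ofReal_im, sub_zero] at this
  exact this

lemma support_subset_of_stieltjes (hν : IsCompact ν.support)
    (hμ : ∀ z : ℂ, 0 < z.im → stieltjes μ z = stieltjes ν (subordination ν 1 z)) :
    μ.support ⊆ Ici (bianeHReal ν 1 (criticalPoint ν)) := by
  refine support_subset_Ici_of_cdf fun x hx ε hε =>
    eventually_measureReal_le_of_subordination_im_eq_zero hμ ?_ ε hε
  obtain ⟨u, hu, rfl⟩ := exists_bianeHReal_eq hν hx.le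
  rw [subordination_bianeHReal hν hu, Complex.ofReal_im]

lemma isCompact_support_of_stieltjes (hν : IsCompact ν.support)
    (hμ : ∀ z : ℂ, 0 < z.im → stieltjes μ z = stieltjes ν (subordination ν 1 z)) :
    IsCompact μ.support := by
  obtain ⟨M, hM⟩ := exists_ae_abs_le hν
  refine isCompact_Icc.of_isClosed_subset Measure.isClosed_support
    (subset_inter (support_subset_of_stieltjes hν hμ)
      (support_subset_Iic_of_cdf (a := M + 2) fun x hx ε hε => ?_))
  exact eventually_measureReal_le_of_subordination_im_eq_zero hμ
    (subordination_im_eq_zero hM ((le_of_lt hx).trans (le_abs_self x))) ε hε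

/-- If c < ℓ this is maximality of c. If c = ℓ, a potential bounded by 1 up to u₁ would give
intervals of radius r mass at most r², so ν would vanish left of u₁, against ℓ being in the support.
-/
lemma exists_ofReal_notMem_bianeClosure (hν : IsCompact ν.support) {u₁ : ℝ}
    (h : criticalPoint ν < u₁) : ∃ u ∈ Icc (criticalPoint ν) u₁, (u : ℂ) ∉ bianeClosure ν := by
  by_contra! hcon
  rcases (criticalPoint_mem hν).1.lt_or_eq with hlt | heq
  · have h1 := hcon (min u₁ (leftEdge ν)) ⟨le_min h.le hlt.le, min_le_left _ _⟩
    exact (le_criticalPoint (min_le_right _ _) h1).not_gt (lt_min h hlt)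
  · refine absurd (support_subset_Ici_of_cdf (m := ν) (a := u₁) (fun x hx ε hε => ?_)
      (leftEdge_mem hν)) (by rw [mem_Ici, not_le, ← heq]; exact h)
    have hxD : (x : ℂ) ∈ bianeClosure ν := by
      rcases le_total x (criticalPoint ν) with h1 | h1
      · exact ofReal_mem_bianeClosure hν h1
      · exact hcon x ⟨h1, le_of_lt hx⟩
    filter_upwards [Ioo_mem_nhdsGT hε] with r hr
    have := measureReal_Icc_le_sq hxD.2 r hr.1
    nlinarith [hr.1, hr.2]

/-- If the edge lay beyond H(c), ω would be real on some [H(c), x₁], moving continuously from c to a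
point beyond c. It would then cross a point outside the closure of Ω, where it cannot take values.
-/
lemma leftEdge_eq_of_stieltjes (hν : IsCompact ν.support)
    (hμ : ∀ z : ℂ, 0 < z.im → stieltjes μ z = stieltjes ν (subordination ν 1 z)) :
    leftEdge μ = bianeHReal ν 1 (criticalPoint ν) := by
  have hμc := isCompact_support_of_stieltjes hν hμ
  refine le_antisymm ?_ (support_subset_of_stieltjes hν hμ (leftEdge_mem hμc))
  by_contra! hlt
  set x₀ := bianeHReal ν 1 (criticalPoint ν) with hx₀
  obtain ⟨x₁, h01, h1⟩ := exists_between hlt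
  have hreal : ∀ x < leftEdge μ, ((subordinationReal ν 1 x : ℝ) : ℂ) = subordination ν 1 x := by
    intro x hx
    have h := stieltjes_eq_of_notMem_support hμ (notMem_support_of_lt hμc hx)
    rw [stieltjes_ofReal] at h
    have := congrArg Complex.im h
    simp only [Complex.ofReal_im, Complex.sub_im, zero_sub] at this
    exact Complex.ext rfl (by rw [Complex.ofReal_im]; linarith)
  have hmem : ∀ x < leftEdge μ, ((subordinationReal ν 1 x : ℝ) : ℂ) ∈ bianeClosure ν :=
    fun x hx => hreal x hx ▸ subordination_mem (by simp)
  have hc0 : subordinationReal ν 1 x₀ = criticalPoint ν := subordinationReal_bianeHReal hν le_rfl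
  have hlt1 : criticalPoint ν < subordinationReal ν 1 x₁ := by
    by_contra! hle
    have h3 : bianeHReal ν 1 (subordinationReal ν 1 x₁) = x₁ := by
      have h4 := bianeH_subordination (ν := ν) (z := (x₁ : ℂ)) (by simp)
      rw [← hreal x₁ h1, bianeH_ofReal] at h4
      exact_mod_cast h4
    rcases hle.lt_or_eq with hl | hl
    · linarith [bianeHReal_lt hν hl le_rfl]
    · rw [hl] at h3
      linarith
  obtain ⟨u, hu, hnot⟩ := exists_ofReal_notMem_bianeClosure hν hlt1
  have hcont : ContinuousOn (subordinationReal ν 1) (Icc x₀ x₁) := by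
    refine (Complex.continuous_re.comp_continuousOn ?_)
    exact continuousOn_subordination.comp Complex.continuous_ofReal.continuousOn
      fun x _ => by simp
  obtain ⟨x, hx, rfl⟩ := intermediate_value_Icc h01.le hcont (hc0.symm ▸ hu)
  exact hnot (hmem x (hx.2.trans_lt h1))

end FreeEdge

/-! ### G to the left of the support -/

section RealStieltjes

variable {m : Measure ℝ} [IsProbabilityMeasure m]

lemma integrable_real_inv_sub {x : ℝ} (hx : x ∉ m.support) :
    Integrable (fun y : ℝ => (x - y)⁻¹) m := by
  have h := (integrable_inv_sub (m := m) (ofReal_notMem_image_support hx)).re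
  refine h.congr (ae_of_all _ fun y => ?_)
  simp only [RCLike.re_to_complex]
  rw [← Complex.ofReal_sub, ← Complex.ofReal_inv, Complex.ofReal_re]

lemma norm_ofReal_inv_sq (x y : ℝ) : ‖((x : ℂ) - (y : ℂ))⁻¹‖ ^ 2 = ((x - y)⁻¹) ^ 2 := by
  rw [← Complex.ofReal_sub, ← Complex.ofReal_inv, Complex.norm_real, Real.norm_eq_abs, sq_abs]

lemma hasDerivAt_stieltjesReal {x : ℝ} (hx : x ∉ m.support) :
    HasDerivAt (stieltjesReal m) (-∫ y : ℝ, ‖((x : ℂ) - (y : ℂ))⁻¹‖ ^ 2 ∂m) x := by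
  have h := (hasDerivAt_stieltjes (m := m) (ofReal_notMem_image_support hx)).real_of_complex
  have e : (fun x : ℝ => (stieltjes m x).re) = stieltjesReal m := by
    ext x
    rw [stieltjes_ofReal, Complex.ofReal_re]
  rw [e] at h
  refine h.congr_deriv ?_
  have e2 : ∫ y : ℝ, (((x : ℂ) - (y : ℂ))⁻¹) ^ 2 ∂m =
      ((∫ y : ℝ, ‖((x : ℂ) - (y : ℂ))⁻¹‖ ^ 2 ∂m : ℝ) : ℂ) := by
    rw [← integral_complex_ofReal]
    congr 1 with y
    rw [norm_ofReal_inv_sq]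
    push_cast
    rfl
  rw [e2, Complex.neg_re, Complex.ofReal_re]

variable (hm : IsCompact m.support)
include hm

lemma le_stieltjesReal {x : ℝ} (hx : x < leftEdge m) :
    (x - leftEdge m)⁻¹ ≤ stieltjesReal m x := by
  have h : ∫ _ : ℝ, (x - leftEdge m)⁻¹ ∂m ≤ stieltjesReal m x := by
    refine integral_mono_ae (integrable_const _)
      (integrable_real_inv_sub (notMem_support_of_lt hm hx)) ?_
    filter_upwards [ae_leftEdge_le hm] with y hy
    exact (inv_le_inv_of_neg (by linarith) (by linarith)).2 (by linarith)
  simpa using h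

lemma stieltjesReal_le {x : ℝ} (hx : x < leftEdge m) :
    stieltjesReal m x ≤ (x - rightEdge m)⁻¹ := by
  have h : stieltjesReal m x ≤ ∫ _ : ℝ, (x - rightEdge m)⁻¹ ∂m := by
    refine integral_mono_ae
      (integrable_real_inv_sub (notMem_support_of_lt hm hx)) (integrable_const _) ?_
    filter_upwards [ae_leftEdge_le hm, ae_le_rightEdge hm] with y hy1 hy2
    exact (inv_le_inv_of_neg (by linarith) (by linarith)).2 (by linarith)
  simpa using h

lemma stieltjesReal_neg {x : ℝ} (hx : x < leftEdge m) : stieltjesReal m x < 0 :=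
  (stieltjesReal_le hm hx).trans_lt (inv_lt_zero.2 (by linarith [leftEdge_le_rightEdge hm]))

lemma stieltjesReal_pos {x : ℝ} (hx : rightEdge m < x) : 0 < stieltjesReal m x := by
  have hns : x ∉ m.support := fun h => (le_rightEdge hm h).not_gt hx
  have h : ∫ _ : ℝ, (x - leftEdge m)⁻¹ ∂m ≤ stieltjesReal m x := by
    refine integral_mono_ae (integrable_const _) (integrable_real_inv_sub hns) ?_
    filter_upwards [ae_leftEdge_le hm, ae_le_rightEdge hm] with y hy1 hy2
    exact inv_anti₀ (by linarith) (by linarith)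
  refine lt_of_lt_of_le ?_ h
  simpa using (leftEdge_le_rightEdge hm).trans_lt hx

lemma integral_norm_inv_sq_pos {x : ℝ} (hx : x < leftEdge m) :
    0 < ∫ y : ℝ, ‖((x : ℂ) - (y : ℂ))⁻¹‖ ^ 2 ∂m := by
  have hb : ∀ᵐ y : ℝ ∂m, ((rightEdge m - x)⁻¹) ^ 2 ≤ ‖((x : ℂ) - (y : ℂ))⁻¹‖ ^ 2 ∧
      ‖((x : ℂ) - (y : ℂ))⁻¹‖ ^ 2 ≤ ((leftEdge m - x)⁻¹) ^ 2 := by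
    filter_upwards [ae_leftEdge_le hm, ae_le_rightEdge hm] with y hy1 hy2
    rw [norm_ofReal_inv_sq, ← neg_sub y x, inv_neg, neg_sq]
    constructor
    · exact pow_le_pow_left₀ (inv_nonneg.2 (by linarith)) (inv_anti₀ (by linarith) (by linarith)) 2
    · exact pow_le_pow_left₀ (inv_nonneg.2 (by linarith)) (inv_anti₀ (by linarith) (by linarith)) 2
  have hI : Integrable (fun y : ℝ => ‖((x : ℂ) - (y : ℂ))⁻¹‖ ^ 2) m := by
    refine Integrable.of_bound ((aestronglyMeasurable_inv_sub m x).norm.pow 2)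
      (((leftEdge m - x)⁻¹) ^ 2) ?_
    filter_upwards [hb] with y hy
    rw [Real.norm_of_nonneg (by positivity)]
    exact hy.2
  have h := integral_mono_ae (integrable_const _) hI (hb.mono fun y hy => hy.1)
  refine lt_of_lt_of_le ?_ h
  have : 0 < rightEdge m - x := by linarith [leftEdge_le_rightEdge hm]
  simp only [integral_const, probReal_univ, smul_eq_mul, one_mul]
  positivity

lemma continuousOn_stieltjesReal_Iio : ContinuousOn (stieltjesReal m) (Iio (leftEdge m)) :=
  fun _ hx =>
    (hasDerivAt_stieltjesReal (notMem_support_of_lt hm hx)).continuousAt.continuousWithinAt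

lemma strictAntiOn_stieltjesReal : StrictAntiOn (stieltjesReal m) (Iio (leftEdge m)) := by
  refine strictAntiOn_of_deriv_neg (convex_Iio _) (continuousOn_stieltjesReal_Iio hm)
    fun x hx => ?_
  rw [interior_Iio] at hx
  rw [(hasDerivAt_stieltjesReal (notMem_support_of_lt hm hx)).deriv]
  linarith [integral_norm_inv_sq_pos hm hx]

lemma tendsto_atBot_mul_stieltjesReal :
    Tendsto (fun x => x * stieltjesReal m x) atBot (𝓝 1) := by
  have h : ∀ c : ℝ, Tendsto (fun x : ℝ => x * (x - c)⁻¹) atBot (𝓝 1) := by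
    intro c
    have h1 : Tendsto (fun x : ℝ => 1 + c * (x - c)⁻¹) atBot (𝓝 (1 + c * 0)) :=
      ((tendsto_inv_atBot_zero.comp
        (tendsto_atBot_add_const_right _ (-c) tendsto_id)).const_mul c).const_add 1
    rw [mul_zero, add_zero] at h1
    refine h1.congr' ?_
    filter_upwards [eventually_lt_atBot c] with x hx
    have : x - c ≠ 0 := by linarith
    field_simp
    ring
  refine tendsto_of_tendsto_of_tendsto_of_le_of_le' (h (rightEdge m)) (h (leftEdge m)) ?_ ?_
  · filter_upwards [eventually_lt_atBot (leftEdge m), eventually_lt_atBot 0] with x hx hx0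
    exact mul_le_mul_of_nonpos_left (stieltjesReal_le hm hx) hx0.le
  · filter_upwards [eventually_lt_atBot (leftEdge m), eventually_lt_atBot 0] with x hx hx0
    exact mul_le_mul_of_nonpos_left (le_stieltjesReal hm hx) hx0.le

lemma tendsto_atBot_stieltjesReal : Tendsto (stieltjesReal m) atBot (𝓝 0) := by
  have h := (tendsto_atBot_mul_stieltjesReal hm).mul tendsto_inv_atBot_zero
  rw [mul_zero] at h
  refine h.congr' ?_
  filter_upwards [eventually_lt_atBot 0] with x hx
  rw [mul_comm x, mul_assoc, mul_inv_cancel₀ hx.ne, mul_one]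

end RealStieltjes

/-! ### The logarithmic potential up to the edge -/

section LogPotential

variable {m : Measure ℝ} [IsProbabilityMeasure m] (hm : IsCompact m.support)
include hm

lemma integrable_log_sub {x : ℝ} (hx : x < leftEdge m) :
    Integrable (fun y : ℝ => Real.log |x - y|) m := by
  refine Integrable.of_bound (Measurable.aestronglyMeasurable (by fun_prop))
    (|Real.log (leftEdge m - x)| + |Real.log (rightEdge m - x)|) ?_
  filter_upwards [ae_leftEdge_le hm, ae_le_rightEdge hm] with y hy1 hy2
  rw [abs_sub_comm, abs_of_pos (by linarith), Real.norm_eq_abs]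
  have h1 : Real.log (leftEdge m - x) ≤ Real.log (y - x) :=
    Real.log_le_log (by linarith) (by linarith)
  have h2 : Real.log (y - x) ≤ Real.log (rightEdge m - x) :=
    Real.log_le_log (by linarith) (by linarith)
  rw [abs_le]
  constructor
  · linarith [neg_abs_le (Real.log (leftEdge m - x)), abs_nonneg (Real.log (rightEdge m - x))]
  · linarith [le_abs_self (Real.log (rightEdge m - x)), abs_nonneg (Real.log (leftEdge m - x))]

lemma hasDerivAt_logPotential {x : ℝ} (hx : x < leftEdge m) :
    HasDerivAt (logPotential m) (-stieltjesReal m x) x := by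
  obtain ⟨c, hxc, hc⟩ := exists_between hx
  refine (hasDerivAt_integral_of_dominated_loc_of_deriv_le (F := fun x y => Real.log |x - y|)
    (F' := fun x y => (x - y)⁻¹) (s := Iio c) (bound := fun _ => (leftEdge m - c)⁻¹)
    (Iio_mem_nhds hxc) (Eventually.of_forall fun x => Measurable.aestronglyMeasurable
      (by fun_prop)) (integrable_log_sub hm hx)
    (Measurable.aestronglyMeasurable (by fun_prop)) ?_ (integrable_const _) ?_).2.neg
  · filter_upwards [ae_leftEdge_le hm] with y hy z hz
    have hz : z < c := hz
    rw [norm_inv, Real.norm_eq_abs, abs_sub_comm, abs_of_pos (by linarith)]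
    exact inv_anti₀ (by linarith) (by linarith)
  · filter_upwards [ae_leftEdge_le hm] with y hy z hz
    have hz : z < c := hz
    simp only [Real.log_abs]
    have h := ((hasDerivAt_id z).sub_const y).log (by simp; linarith)
    simpa using h

/-- Squeezed between the potentials of point masses at the two edges. This fixes constants of
integration at -∞. -/
lemma tendsto_atBot_logPotential_add_log :
    Tendsto (fun x => logPotential m x + Real.log (-x)) atBot (𝓝 0) := by
  have h : ∀ c : ℝ, Tendsto (fun x : ℝ => -Real.log (c - x) + Real.log (-x)) atBot (𝓝 0) := by
    intro c
    have h1 : Tendsto (fun x : ℝ => 1 + (-c) * x⁻¹) atBot (𝓝 (1 + (-c) * 0)) :=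
      (tendsto_inv_atBot_zero.const_mul _).const_add 1
    rw [mul_zero, add_zero] at h1
    have h2 := ((Real.continuousAt_log one_ne_zero).tendsto.comp h1).neg
    rw [Real.log_one, neg_zero] at h2
    refine h2.congr' ?_
    filter_upwards [eventually_lt_atBot 0, eventually_lt_atBot c] with x hx hxc
    have e : 1 + (-c) * x⁻¹ = (c - x) / (-x) := by
      have := hx.ne
      field_simp
      ring
    simp only [Function.comp_apply]
    rw [e, Real.log_div (by linarith) (by linarith)]
    ring
  have hb : ∀ᶠ x in atBot, -Real.log (rightEdge m - x) ≤ logPotential m x ∧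
      logPotential m x ≤ -Real.log (leftEdge m - x) := by
    filter_upwards [eventually_lt_atBot (leftEdge m)] with x hx
    have hi := integrable_log_sub hm hx
    constructor
    · refine neg_le_neg ?_
      have := integral_mono_ae hi (integrable_const (Real.log (rightEdge m - x))) (by
        filter_upwards [ae_leftEdge_le hm, ae_le_rightEdge hm] with y hy1 hy2
        rw [abs_sub_comm, abs_of_pos (by linarith)]
        exact Real.log_le_log (by linarith) (by linarith))
      simpa using this
    · refine neg_le_neg ?_
      have := integral_mono_ae (integrable_const (Real.log (leftEdge m - x))) hi (by
        filter_upwards [ae_leftEdge_le hm, ae_le_rightEdge hm] with y hy1 hy2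
        rw [abs_sub_comm, abs_of_pos (by linarith)]
        exact Real.log_le_log (by linarith) (by linarith))
      simpa using this
  refine tendsto_of_tendsto_of_tendsto_of_le_of_le' (h (rightEdge m)) (h (leftEdge m)) ?_ ?_
  · filter_upwards [hb] with x hx
    linarith [hx.1]
  · filter_upwards [hb] with x hx
    linarith [hx.2]

/-- Fatou's lemma as x increases to the edge; in [0, ∞] the kernel is ∞ at the edge, so there is no
atom there. -/
lemma ae_leftEdge_lt_and_integrable_inv {C : ℝ} (hC : ∀ x < leftEdge m, C ≤ stieltjesReal m x) :
    (∀ᵐ y ∂m, leftEdge m < y) ∧ Integrable (fun y : ℝ => (y - leftEdge m)⁻¹) m := by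
  set a := leftEdge m with ha
  have hx : ∀ n : ℕ, a - 1 / ((n : ℝ) + 1) < a := fun n => by
    have : (0 : ℝ) < 1 / ((n : ℝ) + 1) := by positivity
    linarith
  have ht : Tendsto (fun n : ℕ => a - 1 / ((n : ℝ) + 1)) atTop (𝓝 a) := by
    simpa using (tendsto_one_div_add_atTop_nhds_zero_nat (𝕜 := ℝ)).const_sub a
  have hle : ∀ x < a, ∫⁻ y, (ENNReal.ofReal (y - x))⁻¹ ∂m ≤ ENNReal.ofReal (-C) := by
    intro x hx
    have h1 : ∫⁻ y, (ENNReal.ofReal (y - x))⁻¹ ∂m = ∫⁻ y, ENNReal.ofReal (-(x - y)⁻¹) ∂m := by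
      refine lintegral_congr_ae ?_
      filter_upwards [ae_leftEdge_le hm] with y hy
      rw [← inv_neg, neg_sub, ENNReal.ofReal_inv_of_pos (by linarith)]
    rw [h1, ← ofReal_integral_eq_lintegral_ofReal (f := fun y => -(x - y)⁻¹)
      (integrable_real_inv_sub (notMem_support_of_lt hm hx)).neg, integral_neg]
    · exact ENNReal.ofReal_le_ofReal (neg_le_neg (hC x hx))
    · filter_upwards [ae_leftEdge_le hm] with y hy
      have : (x - y)⁻¹ ≤ 0 := inv_nonpos.2 (by linarith)
      simpa using this
  have hlim : ∫⁻ y, (ENNReal.ofReal (y - a))⁻¹ ∂m ≤ ENNReal.ofReal (-C) := by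
    calc _ ≤ ∫⁻ y, liminf (fun n : ℕ =>
          (ENNReal.ofReal (y - (a - 1 / ((n : ℝ) + 1))))⁻¹) atTop ∂m := by
          refine lintegral_mono fun y => ?_
          have hc : Continuous fun x : ℝ => (ENNReal.ofReal (y - x))⁻¹ :=
            continuous_inv.comp (ENNReal.continuous_ofReal.comp (by fun_prop))
          exact ((hc.tendsto a).comp ht).liminf_eq.ge
      _ ≤ liminf (fun n : ℕ => ∫⁻ y, (ENNReal.ofReal (y - (a - 1 / ((n : ℝ) + 1))))⁻¹ ∂m)
          atTop := lintegral_liminf_le fun n => by fun_prop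
      _ ≤ liminf (fun _ : ℕ => ENNReal.ofReal (-C)) atTop :=
          liminf_le_liminf (Eventually.of_forall fun n => hle _ (hx n))
      _ = _ := by simp
  have hae : ∀ᵐ y ∂m, a < y := by
    filter_upwards [ae_lt_top (by fun_prop) (hlim.trans_lt ENNReal.ofReal_lt_top).ne] with y hy
    by_contra h
    rw [ENNReal.ofReal_of_nonpos (by linarith)] at hy
    simp at hy
  refine ⟨hae, Measurable.aestronglyMeasurable (by fun_prop), ?_⟩
  rw [hasFiniteIntegral_iff_ofReal]
  · refine lt_of_eq_of_lt (lintegral_congr_ae ?_) (hlim.trans_lt ENNReal.ofReal_lt_top)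
    filter_upwards [hae] with y hy
    rw [ENNReal.ofReal_inv_of_pos (by linarith)]
  · filter_upwards [hae] with y hy
    exact inv_nonneg.2 (by linarith)

/-- Dominated convergence: log t ≥ 1 - 1/t bounds the logarithmic singularity by the integrable (y -
a)⁻¹. -/
lemma tendsto_logPotential_leftEdge {C : ℝ} (hC : ∀ x < leftEdge m, C ≤ stieltjesReal m x) :
    Tendsto (logPotential m) (𝓝[<] (leftEdge m)) (𝓝 (logPotential m (leftEdge m))) := by
  obtain ⟨hae, hint⟩ := ae_leftEdge_lt_and_integrable_inv hm hC
  set a := leftEdge m with ha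
  refine (tendsto_integral_filter_of_dominated_convergence
    (fun y => 1 + (y - a)⁻¹ + |Real.log (rightEdge m - a + 1)|)
    (Eventually.of_forall fun x => Measurable.aestronglyMeasurable (by fun_prop)) ?_
    (((integrable_const _).add hint).add (integrable_const _)) ?_).neg
  · filter_upwards [Ioo_mem_nhdsLT (show a - 1 < a by linarith)] with x hx
    filter_upwards [hae, ae_le_rightEdge hm] with y hy1 hy2
    have hx1 := hx.1
    have hx2 := hx.2
    rw [abs_sub_comm, abs_of_pos (by linarith), Real.norm_eq_abs, abs_le]
    have hya : 0 < y - a := by linarith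
    have h1 : Real.log (y - a) ≤ Real.log (y - x) := Real.log_le_log hya (by linarith)
    have h2 : Real.log (y - x) ≤ Real.log (rightEdge m - a + 1) :=
      Real.log_le_log (by linarith) (by linarith)
    have h3 := Real.one_sub_inv_le_log_of_pos hya
    have h4 : 0 < (y - a)⁻¹ := inv_pos.2 hya
    constructor
    · linarith [abs_nonneg (Real.log (rightEdge m - a + 1))]
    · linarith [le_abs_self (Real.log (rightEdge m - a + 1))]
  · filter_upwards [hae] with y hy
    have hc : ContinuousAt (fun x => Real.log |x - y|) a := by
      refine ContinuousAt.log (by fun_prop) ?_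
      rw [ne_eq, abs_eq_zero, sub_eq_zero]
      exact hy.ne
    exact hc.tendsto.mono_left nhdsWithin_le_nhds

end LogPotential

/-! ### The extended-real value of G at the edge -/

section StieltjesLeft

variable {m : Measure ℝ} [IsProbabilityMeasure m] (hm : IsCompact m.support)
include hm

/-- G is decreasing, so the left limit exists in `EReal` and `limUnder` is not a default value. -/
lemma tendsto_stieltjesLeft {κ : ℝ} (hκ : κ ≤ leftEdge m) :
    Tendsto (fun y : ℝ => (stieltjesReal m y : EReal)) (𝓝[<] κ) (𝓝 (stieltjesLeft m κ)) := by
  have hanti : AntitoneOn (fun y : ℝ => (stieltjesReal m y : EReal)) (Iio κ) := by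
    intro x hx y hy hxy
    exact EReal.coe_le_coe_iff.2 ((strictAntiOn_stieltjesReal hm).antitoneOn
      (lt_of_lt_of_le hx hκ) (lt_of_lt_of_le hy hκ) hxy)
  have h := hanti.tendsto_nhdsLT (OrderBot.bddBelow _)
  rw [stieltjesLeft, h.limUnder_eq]
  exact h

lemma stieltjesLeft_lt {k κ : ℝ} (hκ : κ ≤ leftEdge m) (hk : k < κ) :
    stieltjesLeft m κ < (stieltjesReal m k : EReal) := by
  obtain ⟨k', h1, h2⟩ := exists_between hk
  refine lt_of_le_of_lt (le_of_tendsto (tendsto_stieltjesLeft hm hκ) ?_)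
    (EReal.coe_lt_coe_iff.2 (strictAntiOn_stieltjesReal hm (hk.trans_le hκ) (h2.trans_le hκ) h1))
  filter_upwards [Ioo_mem_nhdsLT h2] with y hy
  exact EReal.coe_le_coe_iff.2 (strictAntiOn_stieltjesReal hm (h2.trans_le hκ)
    (hy.2.trans_le hκ) hy.1).le

lemma stieltjesLeft_eq_coe {κ : ℝ} (hκ : κ < leftEdge m) :
    stieltjesLeft m κ = (stieltjesReal m κ : EReal) := by
  refine tendsto_nhds_unique (tendsto_stieltjesLeft hm hκ.le) ?_
  have h := (hasDerivAt_stieltjesReal (m := m) (notMem_support_of_lt hm hκ)).continuousAt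
  exact ((continuous_coe_real_ereal.tendsto _).comp h).mono_left nhdsWithin_le_nhds

lemma stieltjesLeft_lt_stieltjesLeft {k κ : ℝ} (hκ : κ ≤ leftEdge m) (hk : k < κ) :
    stieltjesLeft m κ < stieltjesLeft m k := by
  rw [stieltjesLeft_eq_coe hm (hk.trans_le hκ)]
  exact stieltjesLeft_lt hm hκ hk

lemma exists_stieltjesReal_eq {κ s : ℝ} (hκ : κ ≤ leftEdge m)
    (hs : stieltjesLeft m κ < (s : EReal)) (hs0 : s < 0) : ∃ k < κ, stieltjesReal m k = s := by
  obtain ⟨k₁, h1, h1κ⟩ := (((tendsto_stieltjesLeft hm hκ).eventually (gt_mem_nhds hs)).and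
    self_mem_nhdsWithin).exists
  have h1 := EReal.coe_lt_coe_iff.1 h1
  obtain ⟨k₂, h2, h2k⟩ := (((tendsto_atBot_stieltjesReal hm).eventually (lt_mem_nhds hs0)).and
    (eventually_lt_atBot k₁)).exists
  have h1κ : k₁ < κ := h1κ
  obtain ⟨k, hk, rfl⟩ := intermediate_value_Icc' h2k.le ((continuousOn_stieltjesReal_Iio hm).mono
    fun y hy => hy.2.trans_lt (h1κ.trans_le hκ)) ⟨h1.le, h2.le⟩
  exact ⟨k, hk.2.trans_lt h1κ, rfl⟩

lemma exists_stieltjesLeft_eq {s : ℝ} (hs : stieltjesLeft m (leftEdge m) ≤ (s : EReal))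
    (hs0 : s < 0) : ∃ κ ≤ leftEdge m, stieltjesLeft m κ = (s : EReal) := by
  rcases hs.eq_or_lt with h | h
  · exact ⟨leftEdge m, le_rfl, h⟩
  · obtain ⟨k, hk, rfl⟩ := exists_stieltjesReal_eq hm le_rfl h hs0
    exact ⟨k, hk.le, stieltjesLeft_eq_coe hm hk⟩

variable {κ L : ℝ} (hκ : κ ≤ leftEdge m) (hL : stieltjesLeft m κ = (L : EReal))
include hκ hL

lemma lt_stieltjesReal_of_stieltjesLeft {k : ℝ} (hk : k < κ) : L < stieltjesReal m k := by
  have h := stieltjesLeft_lt hm hκ hk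
  rw [hL] at h
  exact EReal.coe_lt_coe_iff.1 h

lemma neg_of_stieltjesLeft : L < 0 :=
  (lt_stieltjesReal_of_stieltjesLeft hm hκ hL (sub_one_lt κ)).trans
    (stieltjesReal_neg hm ((sub_one_lt κ).trans_le hκ))

lemma tendsto_stieltjesReal_left : Tendsto (stieltjesReal m) (𝓝[<] κ) (𝓝 L) := by
  have h := tendsto_stieltjesLeft hm hκ
  rw [hL] at h
  exact EReal.tendsto_coe.1 h

lemma tendsto_logPotential_left :
    Tendsto (logPotential m) (𝓝[<] κ) (𝓝 (logPotential m κ)) := by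
  rcases hκ.lt_or_eq with h | h
  · exact (hasDerivAt_logPotential hm h).continuousAt.tendsto.mono_left nhdsWithin_le_nhds
  · subst h
    exact tendsto_logPotential_leftEdge hm
      fun x hx => (lt_stieltjesReal_of_stieltjesLeft hm le_rfl hL hx).le

end StieltjesLeft

/-! ### The R-transform and its primitive -/

section RTransform

variable {m : Measure ℝ} [IsProbabilityMeasure m] (hm : IsCompact m.support)
include hm

/-- The chosen preimage ranges over both half-lines, but G is positive on the right one and
injective on the left one. -/
lemma inverseStieltjes_stieltjesReal {k : ℝ} (hk : k < leftEdge m) :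
    inverseStieltjes m (stieltjesReal m k) = k := by
  have hex : stieltjesReal m k ∈ stieltjesReal m '' (Icc (leftEdge m) (rightEdge m))ᶜ :=
    ⟨k, fun h => h.1.not_gt hk, rfl⟩
  have h1 := Function.invFunOn_mem hex
  have h2 := Function.invFunOn_eq hex
  rw [inverseStieltjes]
  set r := Function.invFunOn (stieltjesReal m) (Icc (leftEdge m) (rightEdge m))ᶜ
    (stieltjesReal m k)
  have hr : r < leftEdge m := by
    by_contra h
    have h3 : rightEdge m < r := by
      by_contra h4
      exact h1 ⟨not_lt.1 h, not_lt.1 h4⟩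
    linarith [stieltjesReal_pos hm h3, stieltjesReal_neg hm hk]
  exact (strictAntiOn_stieltjesReal hm).injOn hr hk h2

lemma rTransform_stieltjesReal {k : ℝ} (hk : k < leftEdge m) :
    rTransform m (stieltjesReal m k) = k - 1 / stieltjesReal m k := by
  rw [rTransform, inverseStieltjes_stieltjesReal hm hk]

/-- Compare G with the transforms of point masses at the edges. Hence R is bounded near s = 0, where
K(s) and 1/s both blow up. -/
lemma rTransform_mem_Icc {k : ℝ} (hk : k < leftEdge m) :
    rTransform m (stieltjesReal m k) ∈ Icc (leftEdge m) (rightEdge m) := by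
  rw [rTransform_stieltjesReal hm hk, one_div]
  have h0 := stieltjesReal_neg hm hk
  have h1 := (inv_le_inv_of_neg h0 (inv_lt_zero.2 (sub_neg.2 hk))).2 (le_stieltjesReal hm hk)
  have h2 := (inv_le_inv_of_neg (inv_lt_zero.2
    (sub_neg.2 (hk.trans_le (leftEdge_le_rightEdge hm)))) h0).2 (stieltjesReal_le hm hk)
  rw [inv_inv] at h1 h2
  constructor <;> linarith

variable {κ L : ℝ} (hκ : κ ≤ leftEdge m) (hL : stieltjesLeft m κ = (L : EReal))
include hκ hL

lemma exists_of_mem_Ioo {s : ℝ} (hs : s ∈ Ioo L 0) : ∃ k < κ, stieltjesReal m k = s :=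
  exists_stieltjesReal_eq hm hκ (by rw [hL]; exact EReal.coe_lt_coe_iff.2 hs.1) hs.2

lemma stieltjesReal_mem_Ioo {k : ℝ} (hk : k < κ) : stieltjesReal m k ∈ Ioo L 0 :=
  ⟨lt_stieltjesReal_of_stieltjesLeft hm hκ hL hk, stieltjesReal_neg hm (hk.trans_le hκ)⟩

lemma inverseStieltjes_lt_iff {s k : ℝ} (hs : s ∈ Ioo L 0) (hk : k < κ) :
    inverseStieltjes m s < k ↔ stieltjesReal m k < s := by
  obtain ⟨k', hk', rfl⟩ := exists_of_mem_Ioo hm hκ hL hs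
  rw [inverseStieltjes_stieltjesReal hm (hk'.trans_le hκ)]
  exact ((strictAntiOn_stieltjesReal hm).lt_iff_gt (hk.trans_le hκ) (hk'.trans_le hκ)).symm

lemma inverseStieltjes_lt {s : ℝ} (hs : s ∈ Ioo L 0) :
    inverseStieltjes m s < κ ∧ stieltjesReal m (inverseStieltjes m s) = s := by
  obtain ⟨k', hk', rfl⟩ := exists_of_mem_Ioo hm hκ hL hs
  rw [inverseStieltjes_stieltjesReal hm (hk'.trans_le hκ)]
  exact ⟨hk', rfl⟩

lemma continuousAt_inverseStieltjes {s : ℝ} (hs : s ∈ Ioo L 0) :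
    ContinuousAt (inverseStieltjes m) s := by
  have hanti : MonotoneOn (fun s => -inverseStieltjes m s) (Ioo L 0) := by
    intro s hs t ht hst
    obtain ⟨k, hk, rfl⟩ := exists_of_mem_Ioo hm hκ hL hs
    obtain ⟨k', hk', rfl⟩ := exists_of_mem_Ioo hm hκ hL ht
    simp only [inverseStieltjes_stieltjesReal hm (hk.trans_le hκ),
      inverseStieltjes_stieltjesReal hm (hk'.trans_le hκ)]
    exact neg_le_neg (((strictAntiOn_stieltjesReal hm).le_iff_ge (hk.trans_le hκ)
      (hk'.trans_le hκ)).1 hst)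
  have himg : Ioi (-κ) ⊆ (fun s => -inverseStieltjes m s) '' Ioo L 0 := by
    intro k hk
    have hk : -k < κ := by
      have : -κ < k := hk
      linarith
    refine ⟨stieltjesReal m (-k), stieltjesReal_mem_Ioo hm hκ hL hk, ?_⟩
    simp only [inverseStieltjes_stieltjesReal hm (hk.trans_le hκ), neg_neg]
  have h := continuousAt_of_monotoneOn_of_image_mem_nhds hanti (Ioo_mem_nhds hs.1 hs.2)
    (mem_of_superset (Ioi_mem_nhds (neg_lt_neg (inverseStieltjes_lt hm hκ hL hs).1)) himg)
  exact h.neg.congr (Eventually.of_forall fun s => neg_neg _)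

/-- A Legendre transform: the terms in K' cancel because S' = -G and G(K(s)) = s. -/
lemma hasDerivAt_potential_inverseStieltjes {s : ℝ} (hs : s ∈ Ioo L 0) :
    HasDerivAt (fun s => s * inverseStieltjes m s - 1 - Real.log (-s)
      + logPotential m (inverseStieltjes m s)) (rTransform m s) s := by
  obtain ⟨h1, h2⟩ := inverseStieltjes_lt hm hκ hL hs
  have h3 := h1.trans_le hκ
  have hK := HasDerivAt.of_local_left_inverse (continuousAt_inverseStieltjes hm hκ hL hs)
    (hasDerivAt_stieltjesReal (notMem_support_of_lt hm h3))
    (neg_ne_zero.2 (integral_norm_inv_sq_pos hm h3).ne') (by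
      filter_upwards [Ioo_mem_nhds hs.1 hs.2] with t ht
      exact (inverseStieltjes_lt hm hκ hL ht).2)
  have hlog : HasDerivAt (fun s : ℝ => Real.log (-s)) (1 / s) s := by
    have h := (hasDerivAt_neg s).log (by linarith [hs.2])
    refine h.congr_deriv ?_
    rw [neg_div_neg_eq]
  have hS := (hasDerivAt_logPotential hm h3).comp s hK
  refine (((((hasDerivAt_id s).mul hK).sub_const 1).sub hlog).add hS).congr_deriv ?_
  rw [h2, rTransform]
  simp only [id]
  ring

lemma tendsto_inverseStieltjes_nhdsGT :
    Tendsto (inverseStieltjes m) (𝓝[>] L) (𝓝[<] κ) := by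
  have hL0 := neg_of_stieltjesLeft hm hκ hL
  refine tendsto_nhdsWithin_iff.2 ⟨tendsto_order.2 ⟨fun k hk => ?_, fun k hk => ?_⟩, ?_⟩
  · obtain ⟨k', h1, h2⟩ := exists_between hk
    filter_upwards [Ioo_mem_nhdsGT (stieltjesReal_mem_Ioo hm hκ hL h2).1,
      Ioo_mem_nhdsGT hL0] with s hs hs0
    have h3 := (inverseStieltjes_lt_iff hm hκ hL hs0 h2).not.2 (not_lt.2 hs.2.le)
    linarith
  · filter_upwards [Ioo_mem_nhdsGT hL0] with s hs
    exact (inverseStieltjes_lt hm hκ hL hs).1.trans hk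
  · filter_upwards [Ioo_mem_nhdsGT hL0] with s hs
    exact (inverseStieltjes_lt hm hκ hL hs).1

lemma tendsto_inverseStieltjes_nhdsLT : Tendsto (inverseStieltjes m) (𝓝[<] 0) atBot := by
  have hL0 := neg_of_stieltjesLeft hm hκ hL
  refine tendsto_atBot.2 fun b => ?_
  set k := min b (κ - 1)
  have hk : k < κ := lt_of_le_of_lt (min_le_right _ _) (sub_one_lt κ)
  filter_upwards [Ioo_mem_nhdsLT (stieltjesReal_mem_Ioo hm hκ hL hk).2, Ioo_mem_nhdsLT hL0]
    with s hs hs0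
  exact ((inverseStieltjes_lt_iff hm hκ hL hs0 hk).2 hs.1).le.trans (min_le_left _ _)

lemma intervalIntegrable_rTransform : IntervalIntegrable (rTransform m) volume L 0 := by
  have hL0 := neg_of_stieltjesLeft hm hκ hL
  rw [intervalIntegrable_iff_integrableOn_Ioo_of_le hL0.le]
  have hc : ContinuousOn (rTransform m) (Ioo L 0) := fun s hs =>
    ((continuousAt_inverseStieltjes hm hκ hL hs).sub
      (continuousAt_const.div continuousAt_id hs.2.ne)).continuousWithinAt
  refine Integrable.of_bound (hc.aestronglyMeasurable measurableSet_Ioo)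
    (max |leftEdge m| |rightEdge m|) ?_
  filter_upwards [ae_restrict_mem measurableSet_Ioo] with s hs
  obtain ⟨k, hk, rfl⟩ := exists_of_mem_Ioo hm hκ hL hs
  have := rTransform_mem_Icc hm (hk.trans_le hκ)
  exact abs_le_max_abs_abs this.1 this.2

/-- As s ↑ 0 the primitive is (sK - 1) - log(sK) + (S(K) + log(-K)) with K → -∞, and each group
tends to 0. One-sided limits at L allow κ to be the edge itself. -/
lemma integral_rTransform :
    ∫ s in (0 : ℝ)..L, rTransform m s = L * κ - 1 - Real.log (-L) + logPotential m κ := by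
  have hL0 := neg_of_stieltjesLeft hm hκ hL
  have h0 := tendsto_inverseStieltjes_nhdsLT hm hκ hL
  have h1 := tendsto_inverseStieltjes_nhdsGT hm hκ hL
  have hbot : Tendsto (fun x => (x * stieltjesReal m x - 1)
      - Real.log (x * stieltjesReal m x) + (logPotential m x + Real.log (-x))) atBot (𝓝 0) := by
    have h2 := tendsto_atBot_mul_stieltjesReal hm
    have h3 := (h2.sub_const 1).sub (h2.log one_ne_zero)
    simpa using h3.add (tendsto_atBot_logPotential_add_log hm)
  rw [intervalIntegral.integral_symm, intervalIntegral.integral_eq_sub_of_hasDerivAt_of_tendsto hL0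
    (fun s hs => hasDerivAt_potential_inverseStieltjes hm hκ hL hs)
    (intervalIntegrable_rTransform hm hκ hL) (fa := L * κ - 1 - Real.log (-L) + logPotential m κ)
    (fb := 0)]
  · ring
  · have hs : Tendsto (fun s : ℝ => s) (𝓝[>] L) (𝓝 L) := nhdsWithin_le_nhds
    exact (((hs.mul (h1.mono_right nhdsWithin_le_nhds)).sub_const 1).sub
      (hs.neg.log (by linarith))).add ((tendsto_logPotential_left hm hκ hL).comp h1)
  · refine (hbot.comp h0).congr' ?_
    filter_upwards [Ioo_mem_nhdsLT hL0, h0.eventually (eventually_lt_atBot 0)] with s hs hx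
    have h2 := (inverseStieltjes_lt hm hκ hL hs).2
    simp only [Function.comp_apply]
    rw [h2, show inverseStieltjes m s * s = (-inverseStieltjes m s) * (-s) by ring,
      Real.log_mul (by linarith) (by linarith [hs.2])]
    ring

end RTransform

/-! ### The spherical term at the edge -/

section SphericalJ

variable {m : Measure ℝ} [IsProbabilityMeasure m]

/-- One formula for both branches of J: κ solves G(κ) = 2θ if possible and is the edge otherwise.
The conditions on L determine κ (`eq_of_stieltjesLeft`). -/
lemma exists_sphericalJ_leftEdge_eq (hm : IsCompact m.support) {θ : ℝ} (hθ : θ < 0) :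
    ∃ κ ≤ leftEdge m, ∃ L : ℝ, stieltjesLeft m κ = (L : EReal) ∧ 2 * θ ≤ L ∧
      (κ < leftEdge m → 2 * θ = L) ∧
      sphericalJ θ m (leftEdge m) =
        θ * κ - 1 / 2 * (1 + Real.log (-(2 * θ))) + 1 / 2 * logPotential m κ := by
  by_cases h : stieltjesLeft m (leftEdge m) ≤ ((2 * θ : ℝ) : EReal)
  · obtain ⟨κ, hκ, hL⟩ := exists_stieltjesLeft_eq hm h (by linarith)
    refine ⟨κ, hκ, 2 * θ, hL, le_rfl, fun _ => rfl, ?_⟩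
    rw [sphericalJ, if_pos h, integral_rTransform hm hκ hL]
    ring
  · have h' := not_le.1 h
    have htop : stieltjesLeft m (leftEdge m) ≠ ⊤ :=
      ((stieltjesLeft_lt hm le_rfl (sub_one_lt _)).trans (EReal.coe_lt_top _)).ne
    have hcoe := EReal.coe_toReal htop ((EReal.bot_lt_coe _).trans h').ne'
    refine ⟨leftEdge m, le_rfl, _, hcoe.symm, ?_, fun h => (h.false).elim, ?_⟩
    · rw [← hcoe] at h'
      exact (EReal.coe_lt_coe_iff.1 h').le
    · rw [sphericalJ, if_neg h, logPotential]
      ring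

end SphericalJ

/-! ### The decreasing branch of H -/

section BianeHReal

variable {ν : Measure ℝ} [IsProbabilityMeasure ν] (hν : IsCompact ν.support)
include hν

lemma hasDerivAt_bianeHReal {x : ℝ} (hx : x < leftEdge ν) :
    HasDerivAt (bianeHReal ν 1) (1 - ∫ y : ℝ, ‖((x : ℂ) - (y : ℂ))⁻¹‖ ^ 2 ∂ν) x := by
  rw [funext (bianeHReal_one (ν := ν))]
  exact (hasDerivAt_id x).add (hasDerivAt_stieltjesReal (notMem_support_of_lt hν hx))

/-- Between c and ℓ, maximality of c gives ∫ (x - y)⁻² dν > 1. -/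
lemma strictAntiOn_bianeHReal :
    StrictAntiOn (bianeHReal ν 1) (Ico (criticalPoint ν) (leftEdge ν)) := by
  refine strictAntiOn_of_deriv_neg (convex_Ico _ _)
    (fun x hx => (hasDerivAt_bianeHReal hν hx.2).continuousAt.continuousWithinAt) fun x hx => ?_
  rw [interior_Ico] at hx
  rw [(hasDerivAt_bianeHReal hν hx.2).deriv, sub_neg]
  by_contra! h
  refine (le_criticalPoint hx.2.le ⟨by simp, ?_⟩).not_gt hx.1
  exact (sqPotential_le_one_iff
    (ofReal_notMem_image_support (notMem_support_of_lt hν hx.2))).2 h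

lemma stieltjesLeft_eq_of_le_criticalPoint {u : ℝ} (hu : u ≤ criticalPoint ν) :
    stieltjesLeft ν u = (stieltjesReal ν u : EReal) := by
  refine tendsto_nhds_unique (tendsto_stieltjesLeft hν (hu.trans (criticalPoint_mem hν).1)) ?_
  have h : ContinuousWithinAt (stieltjesReal ν) (Iio u) u :=
    ((continuousOn_stieltjesReal hν) u hu).mono fun y hy => (le_of_lt hy).trans hu
  exact (continuous_coe_real_ereal.tendsto _).comp h

variable {κ L : ℝ} (hκ : κ ≤ leftEdge ν) (hL : stieltjesLeft ν κ = (L : EReal))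
include hκ hL

lemma tendsto_bianeHReal_left : Tendsto (bianeHReal ν 1) (𝓝[<] κ) (𝓝 (κ + L)) := by
  rw [funext (bianeHReal_one (ν := ν))]
  exact Tendsto.add nhdsWithin_le_nhds (tendsto_stieltjesReal_left hν hκ hL)

end BianeHReal

/-! ### Transforms of ν ⊞ σ₁ in terms of ν -/

section FreeConv

variable {ν : Measure ℝ} [IsProbabilityMeasure ν] (hν : IsCompact ν.support)
include hν

lemma isProbabilityMeasure_freeConvSemicircle :
    IsProbabilityMeasure (freeConvSemicircle ν 1) := by
  obtain ⟨M, hM⟩ := exists_ae_abs_le hν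
  exact (freeConvSemicircle_spec hM).1

lemma stieltjes_freeConvSemicircle (z : ℂ) (hz : 0 < z.im) :
    stieltjes (freeConvSemicircle ν 1) z = stieltjes ν (subordination ν 1 z) := by
  obtain ⟨M, hM⟩ := exists_ae_abs_le hν
  exact (freeConvSemicircle_spec hM).2 z hz

lemma isCompact_support_freeConvSemicircle : IsCompact (freeConvSemicircle ν 1).support := by
  have := isProbabilityMeasure_freeConvSemicircle hν
  exact isCompact_support_of_stieltjes hν (stieltjes_freeConvSemicircle hν)

lemma leftEdge_freeConvSemicircle :
    leftEdge (freeConvSemicircle ν 1) = bianeHReal ν 1 (criticalPoint ν) := by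
  have := isProbabilityMeasure_freeConvSemicircle hν
  exact leftEdge_eq_of_stieltjes hν (stieltjes_freeConvSemicircle hν)

lemma bianeHReal_le_leftEdge {u : ℝ} (hu : u ≤ criticalPoint ν) :
    bianeHReal ν 1 u ≤ leftEdge (freeConvSemicircle ν 1) := by
  rw [leftEdge_freeConvSemicircle hν]
  rcases hu.lt_or_eq with h | h
  · exact (bianeHReal_lt hν h le_rfl).le
  · rw [h]

lemma bianeHReal_lt_leftEdge {u : ℝ} (hu : u < criticalPoint ν) :
    bianeHReal ν 1 u < leftEdge (freeConvSemicircle ν 1) := by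
  rw [leftEdge_freeConvSemicircle hν]
  exact bianeHReal_lt hν hu le_rfl

lemma stieltjesReal_freeConvSemicircle {u : ℝ} (hu : u < criticalPoint ν) :
    stieltjesReal (freeConvSemicircle ν 1) (bianeHReal ν 1 u) = stieltjesReal ν u := by
  have := isProbabilityMeasure_freeConvSemicircle hν
  have h := stieltjes_eq_of_notMem_support (stieltjes_freeConvSemicircle hν)
    (notMem_support_of_lt (isCompact_support_freeConvSemicircle hν) (bianeHReal_lt_leftEdge hν hu))
  rw [subordination_bianeHReal hν hu.le, stieltjes_ofReal, ← Complex.ofReal_sub,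
    Complex.ofReal_inj, bianeHReal_one] at h
  rw [bianeHReal_one, h, add_sub_cancel_left]

lemma tendsto_bianeHReal_nhdsLT {u : ℝ} (hu : u ≤ criticalPoint ν) :
    Tendsto (bianeHReal ν 1) (𝓝[<] u) (𝓝[<] (bianeHReal ν 1 u)) := by
  refine tendsto_nhdsWithin_iff.2 ⟨?_, ?_⟩
  · exact ((continuousOn_bianeHReal hν) u hu).mono fun y hy => (le_of_lt hy).trans hu
  · filter_upwards [self_mem_nhdsWithin] with y hy
    exact bianeHReal_lt hν hy hu

lemma stieltjesLeft_freeConvSemicircle {u : ℝ} (hu : u ≤ criticalPoint ν) :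
    stieltjesLeft (freeConvSemicircle ν 1) (bianeHReal ν 1 u) = (stieltjesReal ν u : EReal) := by
  have := isProbabilityMeasure_freeConvSemicircle hν
  have h1 := (tendsto_stieltjesLeft (isCompact_support_freeConvSemicircle hν)
    (bianeHReal_le_leftEdge hν hu)).comp (tendsto_bianeHReal_nhdsLT hν hu)
  have h2 := tendsto_stieltjesLeft hν (hu.trans (criticalPoint_mem hν).1)
  rw [stieltjesLeft_eq_of_le_criticalPoint hν hu] at h2
  refine tendsto_nhds_unique h1 (h2.congr' ?_)
  filter_upwards [self_mem_nhdsWithin] with v hv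
  simp only [Function.comp_apply]
  rw [stieltjesReal_freeConvSemicircle hν (lt_of_lt_of_le hv hu)]

/-- Since G_μ(H(v)) = G(v), the inverses satisfy K_μ(s) = H(K_ν(s)) = K_ν(s) + s. -/
lemma rTransform_freeConvSemicircle {s : ℝ} (hs : s ∈ Ioo (stieltjesReal ν (criticalPoint ν)) 0) :
    rTransform (freeConvSemicircle ν 1) s = rTransform ν s + s := by
  have := isProbabilityMeasure_freeConvSemicircle hν
  obtain ⟨v, hv, rfl⟩ := exists_of_mem_Ioo hν (criticalPoint_mem hν).1
    (stieltjesLeft_eq_of_le_criticalPoint hν le_rfl) hs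
  rw [rTransform_stieltjesReal hν (hv.trans_le (criticalPoint_mem hν).1),
    ← stieltjesReal_freeConvSemicircle hν hv,
    rTransform_stieltjesReal (isCompact_support_freeConvSemicircle hν)
      (bianeHReal_lt_leftEdge hν hv), stieltjesReal_freeConvSemicircle hν hv, bianeHReal_one]
  ring

/-- Left of c both sides have derivative -G(1 + G'), because G_μ ∘ H = G, and their difference tends
to 0 at -∞. The case u = c follows by a left limit. -/
lemma logPotential_freeConvSemicircle {u : ℝ} (hu : u ≤ criticalPoint ν) :
    logPotential (freeConvSemicircle ν 1) (bianeHReal ν 1 u) =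
      logPotential ν u - 1 / 2 * stieltjesReal ν u ^ 2 := by
  have := isProbabilityMeasure_freeConvSemicircle hν
  set μ := freeConvSemicircle ν 1 with hμ
  have hμc : IsCompact μ.support := isCompact_support_freeConvSemicircle hν
  have hcl := (criticalPoint_mem hν).1
  set h : ℝ → ℝ := fun u => logPotential μ (bianeHReal ν 1 u) -
    (logPotential ν u - 1 / 2 * stieltjesReal ν u ^ 2) with hh
  have hderiv : ∀ v ∈ Iio (criticalPoint ν), HasDerivAt h 0 v := by
    intro v hv
    have hvl : v < leftEdge ν := lt_of_lt_of_le hv hcl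
    have hG := hasDerivAt_stieltjesReal (m := ν) (notMem_support_of_lt hν hvl)
    have h1 := (hasDerivAt_logPotential hμc (bianeHReal_lt_leftEdge hν hv)).comp v
      (hasDerivAt_bianeHReal hν hvl)
    have h2 := (hasDerivAt_logPotential hν hvl).sub ((hG.pow 2).const_mul (1 / 2))
    refine (h1.sub h2).congr_deriv ?_
    rw [stieltjesReal_freeConvSemicircle hν hv]
    push_cast
    ring
  have hbot : Tendsto h atBot (𝓝 0) := by
    have hG := tendsto_atBot_stieltjesReal hν
    have hHbot : Tendsto (bianeHReal ν 1) atBot atBot := by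
      rw [funext (bianeHReal_one (ν := ν))]
      exact Tendsto.atBot_add tendsto_id hG
    have h1 := (tendsto_atBot_logPotential_add_log hμc).comp hHbot
    have h2 := tendsto_atBot_logPotential_add_log hν
    have h3 : Tendsto (fun v => Real.log (1 + stieltjesReal ν v * v⁻¹)) atBot (𝓝 0) := by
      have := ((hG.mul tendsto_inv_atBot_zero).const_add 1).log (by norm_num)
      simpa using this
    have h4 := ((h1.sub h2).sub h3).add ((hG.pow 2).const_mul (1 / 2))
    have e : (0 : ℝ) - 0 - 0 + 1 / 2 * 0 ^ 2 = 0 := by norm_num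
    rw [e] at h4
    refine h4.congr' ?_
    filter_upwards [eventually_lt_atBot 0, hHbot.eventually (eventually_lt_atBot 0)] with v hv hHv
    have e2 : 1 + stieltjesReal ν v * v⁻¹ = (-bianeHReal ν 1 v) / (-v) := by
      rw [bianeHReal_one]
      have := hv.ne
      field_simp
    simp only [Function.comp_apply, hh]
    rw [e2, Real.log_div (by linarith) (by linarith)]
    ring
  have hconst : ∀ v ∈ Iio (criticalPoint ν), h v = 0 := by
    intro v hv
    have h1 : ∀ᶠ w in atBot, h w = h v := by
      filter_upwards [eventually_lt_atBot (criticalPoint ν)] with w hw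
      exact isOpen_Iio.is_const_of_deriv_eq_zero isPreconnected_Iio
        (fun z hz => (hderiv z hz).differentiableAt.differentiableWithinAt)
        (fun z hz => (hderiv z hz).deriv) hw hv
    exact tendsto_nhds_unique ((tendsto_congr' h1).2 tendsto_const_nhds) hbot
  have hlim1 := (tendsto_logPotential_left hμc (bianeHReal_le_leftEdge hν hu)
    (stieltjesLeft_freeConvSemicircle hν hu)).comp (tendsto_bianeHReal_nhdsLT hν hu)
  have hul := hu.trans hcl
  have hLu := stieltjesLeft_eq_of_le_criticalPoint hν hu
  have hlim2 := (tendsto_logPotential_left hν hul hLu).sub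
    (((tendsto_stieltjesReal_left hν hul hLu).pow 2).const_mul (1 / 2))
  refine tendsto_nhds_unique hlim1 (hlim2.congr' ?_)
  filter_upwards [self_mem_nhdsWithin] with v hv
  have := hconst v (lt_of_lt_of_le hv hu)
  simp only [hh] at this
  simp only [Function.comp_apply]
  linarith

lemma freeEdge_eq : freeEdge ν 1 = bianeHReal ν 1 (criticalPoint ν) :=
  leftEdge_freeConvSemicircle hν

lemma subordinationReal_freeEdge : subordinationReal ν 1 (freeEdge ν 1) = criticalPoint ν := by
  rw [freeEdge_eq hν, subordinationReal_bianeHReal hν le_rfl]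

end FreeConv

/-- The function `k ↦ (x - k)² / 4 - S_ν(k) / 2` whose increments are the values of the rate
function. -/
noncomputable def ratePotential (ν : Measure ℝ) (x k : ℝ) : ℝ :=
  1 / 4 * (x - k) ^ 2 - 1 / 2 * logPotential ν k

/-! ### Monotonicity of F -/

section RatePotential

variable {ν : Measure ℝ} [IsProbabilityMeasure ν] (hν : IsCompact ν.support)
include hν

lemma hasDerivAt_ratePotential (x : ℝ) {k : ℝ} (hk : k < leftEdge ν) :
    HasDerivAt (ratePotential ν x) (1 / 2 * (bianeHReal ν 1 k - x)) k := by
  have h1 := ((((hasDerivAt_id k).const_sub x).pow 2).const_mul (1 / 4)).sub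
    ((hasDerivAt_logPotential hν hk).const_mul (1 / 2))
  refine h1.congr_deriv ?_
  rw [bianeHReal_one]
  simp only [id]
  push_cast
  ring

lemma continuousOn_ratePotential (x : ℝ) {a κ L : ℝ} (hκ : κ ≤ leftEdge ν)
    (hL : stieltjesLeft ν κ = (L : EReal)) : ContinuousOn (ratePotential ν x) (Icc a κ) := by
  intro k hk
  rcases hk.2.lt_or_eq with h | rfl
  · exact (hasDerivAt_ratePotential hν x (h.trans_le hκ)).continuousAt.continuousWithinAt
  · have h1 : ContinuousWithinAt (logPotential ν) (Iio k) k :=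
      tendsto_logPotential_left hν hκ hL
    have h2 : ContinuousWithinAt (logPotential ν) (Iic k) k :=
      continuousWithinAt_Iio_iff_Iic.1 h1
    refine ContinuousWithinAt.mono (t := Iic k) ?_ Icc_subset_Iic_self
    exact ((by fun_prop : ContinuousAt (fun k => 1 / 4 * (x - k) ^ 2) k).continuousWithinAt).sub
      (h2.const_mul _)

lemma ratePotential_le_of_le {x a κ L : ℝ} (hκ : κ ≤ leftEdge ν)
    (hL : stieltjesLeft ν κ = (L : EReal)) (haκ : a ≤ κ)
    (hH : ∀ k ∈ Ioo a κ, x ≤ bianeHReal ν 1 k) : ratePotential ν x a ≤ ratePotential ν x κ := by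
  refine monotoneOn_of_deriv_nonneg (convex_Icc a κ) (continuousOn_ratePotential hν x hκ hL)
    (fun k hk => ?_) (fun k hk => ?_) ⟨le_rfl, haκ⟩ ⟨haκ, le_rfl⟩ haκ
  all_goals
    rw [interior_Icc] at hk
    have h := hasDerivAt_ratePotential hν x (hk.2.trans_le hκ)
  · exact h.differentiableAt.differentiableWithinAt
  · rw [h.deriv]
    linarith [hH k hk]

lemma ratePotential_le_of_ge {x a κ L : ℝ} (hκ : κ ≤ leftEdge ν)
    (hL : stieltjesLeft ν κ = (L : EReal)) (haκ : a ≤ κ)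
    (hH : ∀ k ∈ Ioo a κ, bianeHReal ν 1 k ≤ x) : ratePotential ν x κ ≤ ratePotential ν x a := by
  refine antitoneOn_of_deriv_nonpos (convex_Icc a κ) (continuousOn_ratePotential hν x hκ hL)
    (fun k hk => ?_) (fun k hk => ?_) ⟨le_rfl, haκ⟩ ⟨haκ, le_rfl⟩ haκ
  all_goals
    rw [interior_Icc] at hk
    have h := hasDerivAt_ratePotential hν x (hk.2.trans_le hκ)
  · exact h.differentiableAt.differentiableWithinAt
  · rw [h.deriv]
    linarith [hH k hk]

end RatePotential

/-! ### The point γ -/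

section GammaPoint

variable {ν : Measure ℝ} [IsProbabilityMeasure ν] (hν : IsCompact ν.support)
include hν

lemma le_bianeHReal_of_mem {u k : ℝ} (hu : u ≤ k) (hk : k ≤ criticalPoint ν) :
    bianeHReal ν 1 u ≤ bianeHReal ν 1 k := by
  rcases hu.lt_or_eq with h | h
  · exact (bianeHReal_lt hν h hk).le
  · rw [h]

/-- Right of c, H decreases to its limit ℓ + L at ℓ, which the hypothesis puts above H(u). -/
lemma le_bianeHReal_of_le_outlierPos {u L : ℝ}
    (hL : stieltjesLeft ν (leftEdge ν) = (L : EReal))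
    (h : leftEdge ν ≤ criticalPoint ν ∨ bianeHReal ν 1 u ≤ leftEdge ν + L) {k : ℝ} (huk : u ≤ k)
    (hk : k < leftEdge ν) : bianeHReal ν 1 u ≤ bianeHReal ν 1 k := by
  rcases le_total k (criticalPoint ν) with hkc | hck
  · exact le_bianeHReal_of_mem hν huk hkc
  rcases h with h | h
  · exact le_bianeHReal_of_mem hν huk (hk.le.trans h)
  refine h.trans (le_of_tendsto (tendsto_bianeHReal_left hν le_rfl hL) ?_)
  filter_upwards [Ioo_mem_nhdsLT hk] with w hw
  exact (strictAntiOn_bianeHReal hν ⟨hck, hk⟩ ⟨hck.trans hw.1.le, hw.2⟩ hw.1).le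

/-- The characterization of `γ = gammaPoint ν 1 (leftEdge ν) x` used below, where `x = H(u)`. -/
lemma gammaPoint_spec {u : ℝ} (hu : u ≤ criticalPoint ν) :
    u ≤ gammaPoint ν 1 (leftEdge ν) (bianeHReal ν 1 u) ∧
    gammaPoint ν 1 (leftEdge ν) (bianeHReal ν 1 u) ≤ leftEdge ν ∧
    (∃ L : ℝ, stieltjesLeft ν (gammaPoint ν 1 (leftEdge ν) (bianeHReal ν 1 u)) = (L : EReal) ∧
      bianeHReal ν 1 u - gammaPoint ν 1 (leftEdge ν) (bianeHReal ν 1 u) ≤ L ∧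
      (gammaPoint ν 1 (leftEdge ν) (bianeHReal ν 1 u) < leftEdge ν →
        bianeHReal ν 1 u - gammaPoint ν 1 (leftEdge ν) (bianeHReal ν 1 u) = L)) ∧
    (∀ k, u ≤ k → k < gammaPoint ν 1 (leftEdge ν) (bianeHReal ν 1 u) →
      bianeHReal ν 1 u ≤ bianeHReal ν 1 k) ∧
    (∀ k, gammaPoint ν 1 (leftEdge ν) (bianeHReal ν 1 u) ≤ k → k < leftEdge ν →
      bianeHReal ν 1 k ≤ bianeHReal ν 1 u) := by
  have hcl := (criticalPoint_mem hν).1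
  set x := bianeHReal ν 1 u with hx
  by_cases hcond : leftEdge ν ≤ subordinationReal ν 1 (freeEdge ν 1) ∨
      (subordinationReal ν 1 (freeEdge ν 1) ≤ leftEdge ν ∧
        (x : EReal) ≤ outlierPos ν 1 (leftEdge ν))
  · have hγ : gammaPoint ν 1 (leftEdge ν) x = leftEdge ν := if_pos hcond
    rw [hγ]
    rw [subordinationReal_freeEdge hν] at hcond
    have htop : stieltjesLeft ν (leftEdge ν) ≠ ⊤ :=
      ((stieltjesLeft_lt hν le_rfl (sub_one_lt _)).trans (EReal.coe_lt_top _)).ne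
    -- G(ℓ) = -∞ would exclude ℓ ≤ c, where G is finite, and make the outlier position -∞.
    have hbot : stieltjesLeft ν (leftEdge ν) ≠ ⊥ := by
      rcases hcond with h | ⟨-, h⟩
      · rw [stieltjesLeft_eq_of_le_criticalPoint hν h]
        exact EReal.coe_ne_bot _
      · intro hb
        rw [outlierPos, hb, EReal.coe_one, one_mul, EReal.add_bot] at h
        exact (EReal.bot_lt_coe x).not_ge h
    obtain ⟨L, hL⟩ : ∃ L : ℝ, stieltjesLeft ν (leftEdge ν) = (L : EReal) :=
      ⟨_, (EReal.coe_toReal htop hbot).symm⟩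
    have hcond' : leftEdge ν ≤ criticalPoint ν ∨ x ≤ leftEdge ν + L := by
      refine hcond.imp_right fun h => ?_
      have h2 := h.2
      rw [outlierPos, hL, EReal.coe_one, one_mul, ← EReal.coe_add] at h2
      exact EReal.coe_le_coe_iff.1 h2
    refine ⟨hu.trans hcl, le_rfl, ⟨L, hL, ?_, fun h => (h.false).elim⟩,
      fun k h1 h2 => le_bianeHReal_of_le_outlierPos hν hL hcond' h1 h2,
      fun k h1 h2 => absurd h2 (not_lt.2 h1)⟩
    rcases hcond' with h | h
    · have h1 := stieltjesLeft_eq_of_le_criticalPoint hν h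
      rw [hL] at h1
      have h2 := le_bianeHReal_of_mem hν (hu.trans hcl) h
      rw [bianeHReal_one (leftEdge ν), ← EReal.coe_injective h1] at h2
      linarith
    · linarith
  · have hγ : gammaPoint ν 1 (leftEdge ν) x = subordinationStar ν 1 x := if_neg hcond
    rw [hγ, subordinationStar]
    rw [subordinationReal_freeEdge hν] at hcond ⊢
    push Not at hcond
    obtain ⟨hlt, hout⟩ := hcond
    have hout := hout hcl
    -- Intermediate values: H(c) ≥ x, while H tends at ℓ to the outlier position, possibly -∞, which
    -- is below x.
    have hex : x ∈ bianeHReal ν 1 '' Ico (criticalPoint ν) (leftEdge ν) := by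
      obtain ⟨k, hk, hkc, hkx⟩ : ∃ k < leftEdge ν, criticalPoint ν < k ∧ bianeHReal ν 1 k < x := by
        have h1 : outlierPos ν 1 (leftEdge ν) < ((x : ℝ) : EReal) := hout
        have h2 : Tendsto (fun k => ((bianeHReal ν 1 k : ℝ) : EReal)) (𝓝[<] (leftEdge ν))
            (𝓝 (outlierPos ν 1 (leftEdge ν))) := by
          have h3 : Tendsto (fun k : ℝ => (k : EReal)) (𝓝[<] (leftEdge ν)) (𝓝 (leftEdge ν : ℝ)) :=
            (continuous_coe_real_ereal.tendsto _).mono_left nhdsWithin_le_nhds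
          simp only [bianeHReal_one, EReal.coe_add]
          rw [outlierPos, EReal.coe_one, one_mul]
          exact (EReal.continuousAt_add (Or.inl (EReal.coe_ne_top _))
            (Or.inl (EReal.coe_ne_bot _))).tendsto.comp
            (h3.prodMk_nhds (tendsto_stieltjesLeft hν le_rfl))
        obtain ⟨k, h5, h6⟩ := ((h2.eventually (gt_mem_nhds h1)).and (Ioo_mem_nhdsLT hlt)).exists
        exact ⟨k, h6.2, h6.1, EReal.coe_lt_coe_iff.1 h5⟩
      have hsub : Icc (criticalPoint ν) k ⊆ Iio (leftEdge ν) := fun w hw => hw.2.trans_lt hk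
      obtain ⟨γ, hγ, hγx⟩ := intermediate_value_Icc' hkc.le
        (fun w hw => (hasDerivAt_bianeHReal hν (hsub hw)).continuousAt.continuousWithinAt)
        ⟨hkx.le, le_bianeHReal_of_mem hν hu le_rfl⟩
      exact ⟨γ, ⟨hγ.1, hsub hγ⟩, hγx⟩
    have h1 := Function.invFunOn_mem hex
    have h2 := Function.invFunOn_eq hex
    set γ := Function.invFunOn (bianeHReal ν 1) (Ico (criticalPoint ν) (leftEdge ν)) x
    have h3 : x - γ = stieltjesReal ν γ := by
      rw [← h2, bianeHReal_one]
      ring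
    refine ⟨hu.trans h1.1, h1.2.le, ⟨_, stieltjesLeft_eq_coe hν h1.2, h3.le, fun _ => h3⟩,
      fun k hk1 hk2 => ?_, fun k hk1 hk2 => ?_⟩
    · rcases le_total k (criticalPoint ν) with hkc | hck
      · exact le_bianeHReal_of_mem hν hk1 hkc
      · rw [← h2]
        exact (strictAntiOn_bianeHReal hν ⟨hck, hk2.trans h1.2⟩ h1 hk2).le
    · rw [← h2]
      exact (strictAntiOn_bianeHReal hν).antitoneOn h1 ⟨h1.1.trans hk1, hk2⟩ hk1

end GammaPoint

/-! ### Comparison of the two rate functions -/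

section Main

variable {ν : Measure ℝ} [IsProbabilityMeasure ν] (hν : IsCompact ν.support)
include hν

lemma ratePotential_le_gammaPoint {u κ L : ℝ} (hu : u ≤ criticalPoint ν) (huκ : u ≤ κ)
    (hκ : κ ≤ leftEdge ν) (hL : stieltjesLeft ν κ = (L : EReal)) :
    ratePotential ν (bianeHReal ν 1 u) κ ≤ ratePotential ν (bianeHReal ν 1 u)
      (gammaPoint ν 1 (leftEdge ν) (bianeHReal ν 1 u)) := by
  obtain ⟨-, hγl, ⟨Lγ, hLγ, -, -⟩, hH1, hH2⟩ := gammaPoint_spec hν hu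
  rcases le_total κ (gammaPoint ν 1 (leftEdge ν) (bianeHReal ν 1 u)) with h | h
  · exact ratePotential_le_of_le hν hγl hLγ h fun k hk => hH1 k (huκ.trans hk.1.le) hk.2
  · exact ratePotential_le_of_ge hν hκ hL h fun k hk => hH2 k hk.1.le (hk.2.trans_le hκ)

lemma rateFunction_bianeHReal {u : ℝ} (hu : u ≤ criticalPoint ν) :
    rateFunction ν 1 (leftEdge ν) (bianeHReal ν 1 u) =
      ((ratePotential ν (bianeHReal ν 1 u) (gammaPoint ν 1 (leftEdge ν) (bianeHReal ν 1 u)) -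
        ratePotential ν (bianeHReal ν 1 u) u : ℝ) : EReal) := by
  have hle : bianeHReal ν 1 u ≤ freeEdge ν 1 := bianeHReal_le_leftEdge hν hu
  rw [rateFunction, if_neg (not_lt.2 hle), subordinationReal_bianeHReal hν hu]
  congr 1
  simp only [ratePotential]
  ring

/-- Both spherical terms are R-transform integrals, and the extra summand s contributes ½ · (2θ)²/2
= θ². -/
lemma mckennaJ_eq_zero {u θ : ℝ} (hu : u ≤ criticalPoint ν) (hθ0 : θ ≤ 0)
    (hθ : stieltjesReal ν u ≤ 2 * θ) : mckennaJ ν (bianeHReal ν 1 u) θ = 0 := by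
  have hcl := (criticalPoint_mem hν).1
  have hul := hu.trans hcl
  have hLu := stieltjesLeft_eq_of_le_criticalPoint hν hu
  have hGc : stieltjesReal ν (criticalPoint ν) ≤ stieltjesReal ν u := by
    rcases hu.lt_or_eq with h | h
    · exact (lt_stieltjesReal_of_stieltjesLeft hν hcl
        (stieltjesLeft_eq_of_le_criticalPoint hν le_rfl) h).le
    · rw [h]
  have hleft : stieltjesLeft ν (leftEdge ν) ≤ ((2 * θ : ℝ) : EReal) := by
    refine le_trans ?_ (EReal.coe_le_coe_iff.2 hθ)
    rw [← hLu]
    rcases hul.lt_or_eq with h | h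
    · exact (stieltjesLeft_lt_stieltjesLeft hν le_rfl h).le
    · rw [h]
  have hleftμ : stieltjesLeft (freeConvSemicircle ν 1) (bianeHReal ν 1 u) ≤
      ((2 * θ : ℝ) : EReal) := by
    rw [stieltjesLeft_freeConvSemicircle hν hu]
    exact EReal.coe_le_coe_iff.2 hθ
  rw [mckennaJ, sphericalJ, if_pos hleftμ, sphericalJ, if_pos hleft]
  rcases hθ0.eq_or_lt with rfl | hneg
  · simp
  obtain ⟨κ, hκ, hL⟩ := exists_stieltjesLeft_eq hν hleft (by linarith)
  have hint := (intervalIntegrable_rTransform hν hκ hL).symm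
  -- The additivity of R is known only on the open interval (G(c), 0), so the endpoints are
  -- discarded first.
  have hcongr : ∫ s in (0 : ℝ)..(2 * θ), rTransform (freeConvSemicircle ν 1) s =
      ∫ s in (0 : ℝ)..(2 * θ), (rTransform ν s + s) := by
    rw [intervalIntegral.integral_symm, intervalIntegral.integral_symm (2 * θ) 0]
    congr 1
    rw [intervalIntegral.integral_of_le (by linarith), intervalIntegral.integral_of_le
      (by linarith), integral_Ioc_eq_integral_Ioo, integral_Ioc_eq_integral_Ioo]
    exact setIntegral_congr_fun measurableSet_Ioo fun s hs =>
      rTransform_freeConvSemicircle hν ⟨(hGc.trans hθ).trans_lt hs.1, hs.2⟩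
  rw [hcongr, intervalIntegral.integral_add hint intervalIntegral.intervalIntegrable_id, integral_id]
  ring

/-- The terms in log(-2θ) cancel, and S_μ(x) = S(u) - (x - u)²/2 because G(u) = x - u. The rest is a
completed square in θ. -/
lemma mckennaJ_eq {u θ κ : ℝ} (hu : u ≤ criticalPoint ν)
    (hθ : 2 * θ < stieltjesReal ν u)
    (hJ : sphericalJ θ ν (leftEdge ν) =
      θ * κ - 1 / 2 * (1 + Real.log (-(2 * θ))) + 1 / 2 * logPotential ν κ) :
    mckennaJ ν (bianeHReal ν 1 u) θ =
      ratePotential ν (bianeHReal ν 1 u) κ - ratePotential ν (bianeHReal ν 1 u) u -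
        1 / 4 * (2 * θ - (bianeHReal ν 1 u - κ)) ^ 2 := by
  have hμ : ¬stieltjesLeft (freeConvSemicircle ν 1) (bianeHReal ν 1 u) ≤
      ((2 * θ : ℝ) : EReal) := by
    rw [stieltjesLeft_freeConvSemicircle hν hu, EReal.coe_le_coe_iff]
    exact not_le.2 hθ
  have hS := logPotential_freeConvSemicircle hν hu
  have hG : stieltjesReal ν u = bianeHReal ν 1 u - u := by rw [bianeHReal_one]; ring
  rw [hG, logPotential] at hS
  rw [mckennaJ, hJ, sphericalJ, if_neg hμ]
  simp only [ratePotential]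
  linear_combination (1 / 2) * hS

lemma eq_of_stieltjesLeft {κ κ' L L' s : ℝ} (hκ : κ ≤ leftEdge ν)
    (hL : stieltjesLeft ν κ = (L : EReal)) (hs : s ≤ L) (hs' : κ < leftEdge ν → s = L)
    (hκ' : κ' ≤ leftEdge ν) (hL' : stieltjesLeft ν κ' = (L' : EReal)) (ht : s ≤ L')
    (ht' : κ' < leftEdge ν → s = L') : κ = κ' := by
  have key : ∀ {κ κ' L L' : ℝ}, stieltjesLeft ν κ = (L : EReal) →
      (κ < leftEdge ν → s = L) → κ' ≤ leftEdge ν → stieltjesLeft ν κ' = (L' : EReal) →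
      s ≤ L' → ¬κ < κ' := by
    intro κ κ' L L' hL hs' hκ' hL' ht hlt
    have h := stieltjesLeft_lt_stieltjesLeft hν hκ' hlt
    rw [hL, hL', EReal.coe_lt_coe_iff] at h
    linarith [hs' (hlt.trans_le hκ')]
  exact le_antisymm (not_lt.1 (key hL' ht' hκ hL hs)) (not_lt.1 (key hL hs' hκ' hL' ht))

lemma mckennaJ_le {u θ : ℝ} (hu : u ≤ criticalPoint ν) (hθ0 : θ ≤ 0) :
    mckennaJ ν (bianeHReal ν 1 u) θ ≤
      ratePotential ν (bianeHReal ν 1 u) (gammaPoint ν 1 (leftEdge ν) (bianeHReal ν 1 u)) -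
        ratePotential ν (bianeHReal ν 1 u) u := by
  have hul := hu.trans (criticalPoint_mem hν).1
  have hLu := stieltjesLeft_eq_of_le_criticalPoint hν hu
  rcases le_or_gt (stieltjesReal ν u) (2 * θ) with h | h
  · rw [mckennaJ_eq_zero hν hu hθ0 h]
    exact sub_nonneg.2 (ratePotential_le_gammaPoint hν hu le_rfl hul hLu)
  · have hθ : θ < 0 := by
      have := neg_of_stieltjesLeft hν hul hLu
      linarith
    obtain ⟨κ, hκ, L, hL, hs, hs', hJ⟩ := exists_sphericalJ_leftEdge_eq hν hθ
    -- G decreases and κ < u would give G(κ) = 2θ < G(u).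
    have huκ : u ≤ κ := by
      by_contra! hlt
      have h1 := stieltjesLeft_lt_stieltjesLeft hν hul hlt
      rw [hL, hLu, EReal.coe_lt_coe_iff] at h1
      linarith [hs' (hlt.trans_le hul)]
    rw [mckennaJ_eq hν hu h hJ]
    have := ratePotential_le_gammaPoint hν hu huκ hκ hL
    linarith [sq_nonneg (2 * θ - (bianeHReal ν 1 u - κ))]

lemma exists_mckennaJ_eq {u : ℝ} (hu : u ≤ criticalPoint ν) :
    ∃ θ ≤ 0, mckennaJ ν (bianeHReal ν 1 u) θ =
      ratePotential ν (bianeHReal ν 1 u) (gammaPoint ν 1 (leftEdge ν) (bianeHReal ν 1 u)) -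
        ratePotential ν (bianeHReal ν 1 u) u := by
  have hul := hu.trans (criticalPoint_mem hν).1
  have hLu := stieltjesLeft_eq_of_le_criticalPoint hν hu
  obtain ⟨huγ, hγl, ⟨Lγ, hLγ, ht, ht'⟩, -, -⟩ := gammaPoint_spec hν hu
  set γ := gammaPoint ν 1 (leftEdge ν) (bianeHReal ν 1 u)
  have hG0 := neg_of_stieltjesLeft hν hul hLu
  rcases huγ.eq_or_lt with h | h
  · refine ⟨0, le_rfl, ?_⟩
    rw [← h, sub_self]
    exact mckennaJ_eq_zero hν hu le_rfl (by linarith)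
  · have h1 := stieltjesLeft_lt_stieltjesLeft hν hγl h
    rw [hLγ, hLu, EReal.coe_lt_coe_iff] at h1
    -- The value that makes the square vanish once κ = γ; it is negative since x - γ ≤ G(γ) < G(u) <
    -- 0, with G(γ) the left limit.
    set θ := (bianeHReal ν 1 u - γ) / 2 with hθdef
    have h2θ : 2 * θ = bianeHReal ν 1 u - γ := by rw [hθdef]; ring
    have hθ : θ < 0 := by linarith
    obtain ⟨κ, hκ, L, hL, hs, hs', hJ⟩ := exists_sphericalJ_leftEdge_eq hν hθ
    have hκγ : κ = γ := eq_of_stieltjesLeft hν hκ hL hs hs' hγl hLγ (h2θ ▸ ht) (h2θ ▸ ht')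
    refine ⟨θ, hθ.le, ?_⟩
    rw [mckennaJ_eq hν hu (by linarith) hJ, hκγ, h2θ]
    ring

end Main

theorem mainTheorem5 (ν : Measure ℝ) [IsProbabilityMeasure ν] (hν : IsCompact ν.support) :
    mckennaRate ν = rateFunction ν 1 (leftEdge ν) := by
  ext1 x
  rcases lt_or_ge (freeEdge ν 1) x with hx | hx
  · rw [mckennaRate, rateFunction, if_pos hx, if_pos hx]
  obtain ⟨u, hu, rfl⟩ := exists_bianeHReal_eq hν (hx.trans_eq (freeEdge_eq hν))
  rw [rateFunction_bianeHReal hν hu, mckennaRate, if_neg (not_lt.2 hx)]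
  refine le_antisymm (iSup_le fun θ => EReal.coe_le_coe_iff.2 (mckennaJ_le hν hu θ.2)) ?_
  obtain ⟨θ, hθ, h⟩ := exists_mckennaJ_eq hν hu
  rw [← h]
  exact le_iSup (fun θ : Iic (0 : ℝ) => (mckennaJ ν (bianeHReal ν 1 u) θ : EReal)) ⟨θ, hθ⟩
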